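/- Let $\rho_0\in(0,1)$ and $\lambda_1>0$. There is a number $T_0=T_0(\rho_0,\lambda_1)>0$ such that the following holds for all $t_0\ge T_0$. (1) For every $\lambda\ge\lambda_1$ the function $e_\lambda(\rho)=t_0^{\rho-1}E_{\rho,\rho}(-\lambda t_0^\rho)$, where $E_{\rho,\mu}(x)=\sum_{k=0}^\infty \frac{x^k}{\Gamma(\rho k+\mu)}$ is the Mittag-Leffler function, is positive and strictly decreasing in $\rho\in[\rho_0,1]$. (2) Let $H$ be a separable (real or complex) Hilbert space and $A$ a (possibly unbounded) positive self-adjoint operator in $H$ which has a complete orthonormal system of eigenvectors with eigenvalues whose minimum is $\lambda_1$. Let $T\ge t_0$ and $\varphi\in H$. For $\sigma<0$ put $\partial_t^{\sigma}h(t)=\frac{1}{\Gamma(-\sigma)}\int_0^t\frac{h(\xi)}{(t-\xi)^{\sigma+1}}\,d\xi$, put $\partial_t^0h=h$, and let $\partial_t^\rho h=\frac{d}{dt}\partial_t^{\rho-1}h$ for $0<\rho\le1$ (the Riemann–Liouville derivative, which is the ordinary derivative for $\rho=1$). Then for every $\rho\in[\rho_0,1]$ the problem $$\partial_t^\rho u(t)+Au(t)=0\quad(0<t\le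 T),\qquad \lim_{t\to0+}\partial_t^{\rho-1}u(t)=\varphi$$ has exactly one solution $u=u_\rho$ on $(0,T]$ with $\partial_t^\rho u,\ Au\in C((0,T];H)$, and the function $\rho\mapsto W(t_0,\rho)=\|u_\rho(t_0)\|^2$ is decreasing on $[\rho_0,1]$, strictly so if $\varphi\neq0$. -/

import Mathlib

open Set Filter Topology MeasureTheory

noncomputable section

/-- The two-parameter Mittag-Leffler function `E_{ρ,μ}(x) = ∑ xᵏ / Γ(ρ k + μ)`; the series converges
for every real `x` as soon as `ρ > 0`. -/
def mittagLeffler (ρ μ x : ℝ) : ℝ :=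
  ∑' k : ℕ, x ^ k / Real.Gamma (ρ * k + μ)

/-- The fractional integral `∂_t^σ h (t) = (1 / Γ(-σ)) ∫₀ᵗ h(ξ) / (t - ξ)^{σ+1} dξ` of (negative)
order `σ < 0`. -/
def fracIntegral {H : Type*} [NormedAddCommGroup H] [NormedSpace ℝ H]
    (σ : ℝ) (h : ℝ → H) (t : ℝ) : H :=
  (1 / Real.Gamma (-σ)) • ∫ ξ in (0 : ℝ)..t, (1 / (t - ξ) ^ (σ + 1)) • h ξ

/-- The function `∂_t^{ρ-1} h` for `0 < ρ ≤ 1`: a fractional integral when `ρ < 1`, and `h` itself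
when `ρ = 1`. -/
def fracPrimitive {H : Type*} [NormedAddCommGroup H] [NormedSpace ℝ H]
    (ρ : ℝ) (h : ℝ → H) : ℝ → H :=
  if ρ = 1 then h else fracIntegral (ρ - 1) h

/-- On `(0, T]` the function `h` has Riemann-Liouville derivative `D = ∂_t^ρ h = d/dt ∂_t^{ρ-1} h` of
order `0 < ρ ≤ 1` (the classical derivative when `ρ = 1`). The integrals that define `∂_t^{ρ-1} h` are
required to exist, and the derivative at the endpoint `T` is one-sided. -/
structure HasRLDerivOn {H : Type*} [NormedAddCommGroup H] [NormedSpace ℝ H]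
    (ρ T : ℝ) (h D : ℝ → H) : Prop where
  integrable : ρ < 1 → ∀ t ∈ Ioc 0 T,
    IntervalIntegrable (fun ξ : ℝ => (1 / (t - ξ) ^ (ρ - 1 + 1)) • h ξ) volume 0 t
  hasDeriv : ∀ t ∈ Ioc 0 T, HasDerivWithinAt (fracPrimitive ρ h) (D t) (Ioc 0 T) t

/-- `u` is a solution of the forward problem
`∂_t^ρ u(t) + A u(t) = 0` for `0 < t ≤ T`, `lim_{t → 0+} ∂_t^{ρ-1} u(t) = φ`,
with `∂_t^ρ u` and `A u` in `C((0, T]; H)`. Here `D` is `∂_t^ρ u`, and `Au` is `t ↦ A (u t)`, that is,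
`u t` lies in the domain of `A` and is mapped to `Au t`. Only the values of `u` on `(0, T]` matter. -/
def IsForwardSolution {𝕜 H : Type*} [RCLike 𝕜] [NormedAddCommGroup H] [InnerProductSpace 𝕜 H]
    [NormedSpace ℝ H] (A : H →ₗ.[𝕜] H) (ρ T : ℝ) (φ : H) (u : ℝ → H) : Prop :=
  ∃ D Au : ℝ → H,
    HasRLDerivOn ρ T u D ∧
    (∀ t ∈ Ioc 0 T, (u t, Au t) ∈ A.graph) ∧
    ContinuousOn D (Ioc 0 T) ∧
    ContinuousOn Au (Ioc 0 T) ∧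
    (∀ t ∈ Ioc 0 T, D t + Au t = 0) ∧
    Tendsto (fracPrimitive ρ u) (𝓝[>] 0) (𝓝 φ)

/-- A (possibly unbounded, densely defined) positive self-adjoint operator. -/
structure IsPositiveSelfAdjoint {𝕜 H : Type*} [RCLike 𝕜] [NormedAddCommGroup H]
    [InnerProductSpace 𝕜 H] [CompleteSpace H] (A : H →ₗ.[𝕜] H) : Prop where
  dense : Dense (A.domain : Set H)
  selfAdjoint : IsSelfAdjoint A
  pos : ∀ x : A.domain, (x : H) ≠ 0 → 0 < RCLike.re (inner 𝕜 (A x) (x : H))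

end

/-! Everything reduces to the scalar functions e_λ(t) = `relaxation lam ρ ρ t`. By Parseval,
‖u_ρ(t₀)‖² = ∑ e_{λ_k}(t₀)² |φ_k|², so positivity and strict decrease of each e_λ(t₀) in ρ, with one
threshold T₀ for all λ ≥ λ₁, give the claim about W.

To see the dependence on ρ, the series for e_λ is rewritten as an inverse Laplace integral of
e^{st}/(s^ρ + λ). Hankel's formula for t^{μ-1}/Γ(μ), summed over the geometric expansion of 1/(s^ρ +
λ) far from 0, gives that integral over a Hankel contour; collapsing the contour onto the negative
axis gives `pi_mul_relaxation_eq_integral` for ρ < 1. Its integrand is positive and decreases in t,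
whence positivity, monotonicity in t and the bounds t^{ρ-1}/Γ(ρ) and 1/(λt).

For large t, expand 1/(w + λ) = 1/λ - w/λ² + w²/(λ²(w + λ)) with w = s^ρ. The first term contributes
nothing, the second gives the main term t^{-1-ρ} Γ(1+ρ) sin(ρπ), and the third is a remainder
(`pi_mul_sq_mul_relaxation`). On the negative axis the denominator of the remainder degenerates as ρ
→ 1, so its contour is turned to the ray of angle 2π/3, where |w + λ| ≥ λ/2 for every ρ and e^{st}
still decays. There the ρ-derivative of the remainder is O(t^{-1-2ρ}(1 + log t)/λ), while that of
the main term is at most -t^{-1-ρ} once log t is large (`exists_main_term_le`): away from ρ = 1 the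
factor -log t wins, near ρ = 1 the derivative of the sine does. Hence the derivative in ρ is
negative for t ≥ T₀.

The solution is the eigenfunction series. Existence rests on the bounds above and the closedness of
A. For uniqueness, each coordinate of a difference of solutions solves a scalar homogeneous
equation, which Abel inversion turns into a weakly singular Volterra equation having only the zero
solution (`HasRLDerivOn.eq_zero`). -/

/-- The function `t ↦ t^{μ-1} E_{ρ,μ}(-λ t^ρ)`. -/
noncomputable def relaxation (lam ρ μ t : ℝ) : ℝ :=
  t ^ (μ - 1) * mittagLeffler ρ μ (-lam * t ^ ρ)

/-! ### Growth of Gamma; convergence and continuity of the Mittag-Leffler series -/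

/-- Keep only the part of the Gamma integral over [B, B+1] and write x^(s-1) = x^s / x ≥ B^s /
(B+1), which avoids a case distinction on the sign of s - 1. -/
theorem exists_mul_rpow_le_Gamma {B : ℝ} (hB : 1 ≤ B) :
    ∃ c : ℝ, 0 < c ∧ ∀ s : ℝ, 0 < s → c * B ^ s ≤ Real.Gamma s := by
  have hB0 : 0 < B := by linarith
  refine ⟨Real.exp (-(B + 1)) / (B + 1), by positivity, fun s hs => ?_⟩
  have hint := Real.GammaIntegral_convergent hs
  rw [Real.Gamma_eq_integral hs]
  calc Real.exp (-(B + 1)) / (B + 1) * B ^ s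
      = ∫ _ in Ioc B (B + 1), Real.exp (-(B + 1)) / (B + 1) * B ^ s := by simp
    _ ≤ ∫ x in Ioc B (B + 1), Real.exp (-x) * x ^ (s - 1) := by
        refine setIntegral_mono_on continuous_const.integrableOn_Ioc (hint.mono_set ?_) measurableSet_Ioc ?_
        · exact fun x hx => hB0.trans hx.1
        · intro x hx
          have hx0 : 0 < x := hB0.trans hx.1
          rw [div_mul_eq_mul_div, mul_div_assoc]
          refine mul_le_mul (Real.exp_le_exp.2 (by linarith [hx.2])) ?_ (by positivity)
            (by positivity)
          rw [Real.rpow_sub hx0, Real.rpow_one]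
          exact div_le_div₀ (by positivity) (Real.rpow_le_rpow hB0.le hx.1.le hs.le) hx0 hx.2
    _ ≤ ∫ x in Ioi 0, Real.exp (-x) * x ^ (s - 1) := by
        refine setIntegral_mono_set hint ?_ ?_
        · filter_upwards [ae_restrict_mem measurableSet_Ioi] with x hx
          have : (0 : ℝ) < x := hx
          simp only [Pi.zero_apply]; positivity
        · exact (show Ioc B (B + 1) ⊆ Ioi 0 from fun x hx => hB0.trans hx.1).eventuallyLE

/-- With B = Q^(1/ρ₀) and Q ≥ 1 one has B^(ρk+μ) ≥ Q^k for every ρ ≥ ρ₀, so the terms are dominated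
by a geometric series of ratio R/Q < 1. One majorant serves all orders, which gives continuity in ρ
as well as in x. -/
theorem exists_summable_pow_div_Gamma_le {ρ₀ R : ℝ} (hρ₀ : 0 < ρ₀) (hR : 0 ≤ R) :
    ∃ u : ℕ → ℝ, Summable u ∧ ∀ k : ℕ, ∀ ρ μ : ℝ, ρ₀ ≤ ρ → 0 < μ →
      R ^ k / Real.Gamma (ρ * k + μ) ≤ u k := by
  set Q := 2 * R + 1
  have hQ : 1 ≤ Q := by simp only [Q]; linarith
  have hB : 1 ≤ Q ^ (1 / ρ₀) := Real.one_le_rpow hQ (by positivity)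
  obtain ⟨c, hc, h⟩ := exists_mul_rpow_le_Gamma hB
  refine ⟨fun k => c⁻¹ * (R / Q) ^ k, ?_, fun k ρ μ hρ hμ => ?_⟩
  · refine (summable_geometric_of_lt_one (by positivity) ?_).mul_left _
    rw [div_lt_one (by positivity)]; simp only [Q]; linarith
  · have hρ0 : 0 < ρ := hρ₀.trans_le hρ
    have h1 := h (ρ * k + μ) (by positivity)
    have h2 : Q ^ k ≤ (Q ^ (1 / ρ₀)) ^ (ρ * k + μ) := by
      calc Q ^ k = (Q ^ (1 / ρ₀)) ^ (ρ₀ * k) := by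
            rw [← Real.rpow_mul (by positivity), ← Real.rpow_natCast]
            congr 1; field_simp
        _ ≤ _ := Real.rpow_le_rpow_of_exponent_le hB (by
            have := mul_le_mul_of_nonneg_right hρ (Nat.cast_nonneg (α := ℝ) k); linarith)
    calc R ^ k / Real.Gamma (ρ * k + μ) ≤ R ^ k / (c * Q ^ k) :=
          div_le_div_of_nonneg_left (by positivity) (by positivity)
            ((mul_le_mul_of_nonneg_left h2 hc.le).trans h1)
      _ = c⁻¹ * (R / Q) ^ k := by rw [div_pow]; field_simp

theorem Gamma_mul_nat_add_pos {ρ μ : ℝ} (hρ : 0 ≤ ρ) (hμ : 0 < μ) (k : ℕ) :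
    0 < Real.Gamma (ρ * k + μ) := Real.Gamma_pos_of_pos (by positivity)

theorem summable_pow_div_Gamma {ρ μ : ℝ} (hρ : 0 < ρ) (hμ : 0 < μ) (x : ℝ) :
    Summable fun k : ℕ => x ^ k / Real.Gamma (ρ * k + μ) := by
  obtain ⟨u, hu, h⟩ := exists_summable_pow_div_Gamma_le hρ (abs_nonneg x)
  refine hu.of_norm_bounded fun k => ?_
  rw [norm_div, norm_pow, Real.norm_eq_abs, Real.norm_of_nonneg (Gamma_mul_nat_add_pos hρ.le hμ k).le]
  exact h k ρ μ le_rfl hμ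

theorem continuous_mittagLeffler {ρ μ : ℝ} (hρ : 0 < ρ) (hμ : 0 < μ) :
    Continuous (mittagLeffler ρ μ) := by
  rw [continuous_iff_continuousAt]
  intro x
  obtain ⟨u, hu, h⟩ := exists_summable_pow_div_Gamma_le (R := |x| + 1) hρ (by positivity)
  have : ContinuousOn (mittagLeffler ρ μ) (Metric.ball x 1) := by
    refine continuousOn_tsum (fun k => by fun_prop) hu fun k y hy => ?_
    rw [norm_div, norm_pow, Real.norm_eq_abs,
      Real.norm_of_nonneg (Gamma_mul_nat_add_pos hρ.le hμ k).le]
    refine le_trans ?_ (h k ρ μ le_rfl hμ)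
    have := (Gamma_mul_nat_add_pos hρ.le hμ k).le
    have hy' : |y| ≤ |x| + 1 := by
      have h1 : |y - x| < 1 := hy
      have h2 := abs_sub_abs_le_abs_sub y x
      linarith
    gcongr
  exact this.continuousAt (Metric.ball_mem_nhds x one_pos)

theorem continuousOn_relaxation {lam ρ μ : ℝ} (hρ : 0 < ρ) (hμ : 0 < μ) :
    ContinuousOn (relaxation lam ρ μ) (Ioi 0) := by
  intro t ht
  have ht' : t ≠ 0 := ne_of_gt ht
  refine ContinuousAt.continuousWithinAt ?_
  exact (Real.continuousAt_rpow_const _ _ (Or.inl ht')).mul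
    ((continuous_mittagLeffler hρ hμ).continuousAt.comp
      (continuousAt_const.mul (Real.continuousAt_rpow_const _ _ (Or.inl ht'))))

/-- This is what carries the monotonicity to the endpoint ρ = 1, where the integral representation
below is not available. -/
theorem continuousOn_relaxation_order {lam ρ₀ t : ℝ} (hρ₀ : 0 < ρ₀) (ht : 0 < t) :
    ContinuousOn (fun ρ => relaxation lam ρ ρ t) (Icc ρ₀ 1) := by
  have hpow : Continuous fun ρ : ℝ => t ^ ρ := Real.continuous_const_rpow ht.ne'
  refine ContinuousOn.mul (hpow.comp (continuous_id.sub continuous_const)).continuousOn ?_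
  obtain ⟨u, hu, h⟩ := exists_summable_pow_div_Gamma_le (R := |lam| * (1 + t)) hρ₀ (by positivity)
  refine continuousOn_tsum (fun k => ?_) hu fun k ρ hρ => ?_
  · refine ContinuousOn.div (by fun_prop) ?_ fun ρ hρ =>
      (Gamma_mul_nat_add_pos (hρ₀.trans_le hρ.1).le (hρ₀.trans_le hρ.1) k).ne'
    intro ρ hρ
    have hpos : 0 < ρ * k + ρ := by
      have := hρ₀.trans_le hρ.1
      positivity
    refine ContinuousAt.continuousWithinAt ?_
    have h1 : ContinuousAt Real.Gamma (ρ * k + ρ) :=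
      (Real.differentiableAt_Gamma fun m hm => by
        have : (0 : ℝ) ≤ m := Nat.cast_nonneg m
        linarith).continuousAt
    exact ContinuousAt.comp (f := fun ρ : ℝ => ρ * k + ρ) h1 (by fun_prop)
  · have hρ0 := hρ₀.trans_le hρ.1
    rw [norm_div, norm_pow, Real.norm_eq_abs,
      Real.norm_of_nonneg (Gamma_mul_nat_add_pos hρ0.le hρ0 k).le]
    refine le_trans ?_ (h k ρ ρ hρ.1 hρ0)
    have := (Gamma_mul_nat_add_pos hρ0.le hρ0 k).le
    have h2 : |-lam * t ^ ρ| ≤ |lam| * (1 + t) := by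
      rw [abs_mul, abs_neg, abs_of_pos (Real.rpow_pos_of_pos ht ρ)]
      refine mul_le_mul_of_nonneg_left ?_ (abs_nonneg _)
      calc t ^ ρ ≤ (1 + t) ^ ρ := Real.rpow_le_rpow ht.le (by linarith) hρ0.le
        _ ≤ (1 + t) ^ (1 : ℝ) := Real.rpow_le_rpow_of_exponent_le (by linarith) hρ.2
        _ = 1 + t := Real.rpow_one _
    gcongr

theorem relaxation_term {lam ρ μ t : ℝ} (ht : 0 < t) (k : ℕ) :
    t ^ (μ - 1) * ((-lam * t ^ ρ) ^ k / Real.Gamma (ρ * k + μ)) =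
      (-lam) ^ k * (t ^ (ρ * k + μ - 1) / Real.Gamma (ρ * k + μ)) := by
  rw [mul_pow, ← Real.rpow_natCast (t ^ ρ), ← Real.rpow_mul ht.le, add_sub_assoc, Real.rpow_add ht]
  ring

theorem hasSum_relaxation {lam ρ μ t : ℝ} (hρ : 0 < ρ) (hμ : 0 < μ) (ht : 0 < t) :
    HasSum (fun k : ℕ => (-lam) ^ k * (t ^ (ρ * k + μ - 1) / Real.Gamma (ρ * k + μ)))
      (relaxation lam ρ μ t) := by
  simp_rw [← relaxation_term ht]
  exact (summable_pow_div_Gamma hρ hμ _).hasSum.mul_left _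

/-- Split off the term k = 0 and shift the index. -/
theorem relaxation_eq_sub {lam ρ μ t : ℝ} (hρ : 0 < ρ) (hμ : 0 < μ) (ht : 0 < t) :
    relaxation lam ρ μ t = t ^ (μ - 1) / Real.Gamma μ - lam * relaxation lam ρ (μ + ρ) t := by
  rw [(hasSum_relaxation hρ hμ ht).tsum_eq.symm, (hasSum_relaxation hρ hμ ht).summable.tsum_eq_zero_add,
    (hasSum_relaxation (lam := lam) hρ (add_pos hμ hρ) ht).tsum_eq.symm, ← tsum_mul_left,
    sub_eq_add_neg (t ^ (μ - 1) / Real.Gamma μ), ← tsum_neg]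
  congr 1
  · simp
  · congr 1; ext k
    have : ρ * ((k + 1 : ℕ) : ℝ) + μ = ρ * k + (μ + ρ) := by push_cast; ring
    rw [this, pow_succ]; ring

/-! ### Fractional integrals of the relaxation functions -/

/-- Each end carries one singularity. Split at t/2; the right half is the left half after the
reflection ξ ↦ t - ξ, with a and b exchanged. -/
theorem intervalIntegrable_rpow_mul_rpow {a b t : ℝ} (ha : 0 < a) (hb : 0 < b) (ht : 0 < t) :
    IntervalIntegrable (fun ξ : ℝ => (t - ξ) ^ (a - 1) * ξ ^ (b - 1)) volume 0 t := by
  have key : ∀ a b : ℝ, 0 < b →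
      IntervalIntegrable (fun ξ : ℝ => (t - ξ) ^ (a - 1) * ξ ^ (b - 1)) volume 0 (t / 2) := by
    intro a b hb
    refine IntervalIntegrable.continuousOn_mul
      (intervalIntegral.intervalIntegrable_rpow' (by linarith)) ?_
    rw [uIcc_of_le (by positivity)]
    intro x hx
    refine ContinuousAt.continuousWithinAt ?_
    exact ContinuousAt.rpow_const (by fun_prop) (Or.inl (by linarith [hx.2]))
  refine (key a b hb).trans ?_
  have h2 := ((key b a ha).comp_sub_left t).symm
  simp only [sub_sub_cancel, sub_zero] at h2
  convert h2 using 2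
  · ring
  · ring

theorem integral_rpow_mul_rpow {a b t : ℝ} (ha : 0 < a) (hb : 0 < b) (ht : 0 < t) :
    ∫ ξ in (0 : ℝ)..t, (t - ξ) ^ (a - 1) * ξ ^ (b - 1) =
      Real.Gamma a * (Real.Gamma b * (t ^ (b + a - 1) / Real.Gamma (b + a))) := by
  have h := Complex.betaIntegral_scaled b a ht
  rw [Complex.betaIntegral_eq_Gamma_mul_div _ _ (by simpa) (by simpa)] at h
  apply Complex.ofReal_injective
  rw [← intervalIntegral.integral_ofReal]
  push_cast [Complex.ofReal_cpow ht.le, ← Complex.Gamma_ofReal]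
  rw [show Complex.Gamma a * (Complex.Gamma b * ((t : ℂ) ^ (b + a - 1 : ℂ) / Complex.Gamma (b + a)))
    = (t : ℂ) ^ (b + a - 1 : ℂ) * (Complex.Gamma b * Complex.Gamma a / Complex.Gamma (b + a)) by ring,
    ← h]
  refine intervalIntegral.integral_congr fun x hx => ?_
  rw [uIcc_of_le ht.le] at hx
  rw [Complex.ofReal_cpow (by linarith [hx.2]), Complex.ofReal_cpow hx.1]
  push_cast
  ring

theorem intervalIntegrable_rpow_mul_relaxation {lam ρ μ a t : ℝ} (hρ : 0 < ρ) (hμ : 0 < μ)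
    (ha : 0 < a) (ht : 0 < t) :
    IntervalIntegrable (fun ξ : ℝ => (t - ξ) ^ (a - 1) * relaxation lam ρ μ ξ) volume 0 t := by
  simp only [relaxation, ← mul_assoc]
  refine (intervalIntegrable_rpow_mul_rpow ha hμ ht).mul_continuousOn ?_
  exact ((continuous_mittagLeffler hρ hμ).comp
    (continuous_const.mul (Real.continuous_rpow_const hρ.le))).continuousOn

/-- Fractional integration of order a raises μ by a: each power obeys this by the Beta integral, and
absolute convergence permits termwise integration. -/
theorem integral_rpow_mul_relaxation {lam ρ μ a t : ℝ} (hρ : 0 < ρ) (hμ : 0 < μ)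
    (ha : 0 < a) (ht : 0 < t) :
    ∫ ξ in (0 : ℝ)..t, (t - ξ) ^ (a - 1) * relaxation lam ρ μ ξ =
      Real.Gamma a * relaxation lam ρ (μ + a) t := by
  have hG := fun k : ℕ => Gamma_mul_nat_add_pos hρ.le hμ k
  set F : ℕ → ℝ → ℝ := fun k ξ =>
    ((-lam) ^ k / Real.Gamma (ρ * k + μ)) * ((t - ξ) ^ (a - 1) * ξ ^ (ρ * k + μ - 1)) with hF
  have hpos : ∀ k : ℕ, 0 < ρ * k + μ := fun k => by positivity
  have hint : ∀ k, Integrable (F k) (volume.restrict (Ioc 0 t)) := fun k =>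
    ((intervalIntegrable_iff_integrableOn_Ioc_of_le ht.le).1
      (intervalIntegrable_rpow_mul_rpow ha (hpos k) ht)).const_mul _
  have hval : ∀ (c : ℝ) (k : ℕ), ∫ ξ in Ioc 0 t,
      (c ^ k / Real.Gamma (ρ * k + μ)) * ((t - ξ) ^ (a - 1) * ξ ^ (ρ * k + μ - 1)) =
      Real.Gamma a * (c ^ k * (t ^ (ρ * k + (μ + a) - 1) / Real.Gamma (ρ * k + (μ + a)))) := by
    intro c k
    rw [integral_const_mul, ← intervalIntegral.integral_of_le ht.le,
      integral_rpow_mul_rpow ha (hpos k) ht, add_assoc]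
    field_simp [(hG k).ne']
  have hnorm : ∀ k, ∫ ξ in Ioc 0 t, ‖F k ξ‖ =
      Real.Gamma a * (|lam| ^ k * (t ^ (ρ * k + (μ + a) - 1) / Real.Gamma (ρ * k + (μ + a)))) := by
    intro k
    rw [← hval]
    refine setIntegral_congr_fun measurableSet_Ioc fun x hx => ?_
    simp only [hF]
    rw [norm_mul, norm_div, norm_pow, norm_neg, Real.norm_eq_abs, Real.norm_of_nonneg (hG k).le,
      Real.norm_of_nonneg]
    exact mul_nonneg (Real.rpow_nonneg (by linarith [hx.2]) _) (Real.rpow_nonneg hx.1.le _)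
  have hsum := hasSum_integral_of_summable_integral_norm hint (by
    simp_rw [hnorm]
    -- The integrals of the norms form the same series with λ replaced by -|λ|, which makes every
    -- term nonnegative.
    have := (hasSum_relaxation (lam := -|lam|) hρ (add_pos hμ ha) ht).summable.mul_left (Real.Gamma a)
    simpa using this)
  have hpt : ∫ ξ in (0 : ℝ)..t, (t - ξ) ^ (a - 1) * relaxation lam ρ μ ξ =
      ∫ ξ in Ioc 0 t, ∑' k, F k ξ := by
    rw [intervalIntegral.integral_of_le ht.le]
    refine setIntegral_congr_fun measurableSet_Ioc fun x hx => ?_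
    rw [← (hasSum_relaxation hρ hμ hx.1).tsum_eq, ← tsum_mul_left]
    refine tsum_congr fun k => ?_
    simp only [hF]; ring
  rw [hpt, ← hsum.tsum_eq]
  simp_rw [hF, hval]
  rw [tsum_mul_left, (hasSum_relaxation hρ (add_pos hμ ha) ht).tsum_eq]

theorem intervalIntegrable_relaxation {lam ρ μ t : ℝ} (hρ : 0 < ρ) (hμ : 0 < μ) (ht : 0 < t) :
    IntervalIntegrable (relaxation lam ρ μ) volume 0 t := by
  simpa using intervalIntegrable_rpow_mul_relaxation (lam := lam) hρ hμ one_pos ht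

theorem integral_relaxation {lam ρ μ t : ℝ} (hρ : 0 < ρ) (hμ : 0 < μ) (ht : 0 < t) :
    ∫ ξ in (0 : ℝ)..t, relaxation lam ρ μ ξ = relaxation lam ρ (μ + 1) t := by
  simpa using integral_rpow_mul_relaxation (lam := lam) hρ hμ one_pos ht

theorem relaxation_one_one {lam t : ℝ} : relaxation lam 1 1 t = Real.exp (-lam * t) := by
  rw [relaxation, mittagLeffler, Real.exp_eq_exp_ℝ, NormedSpace.exp_eq_tsum_div]
  simp [Real.Gamma_nat_eq_factorial]

/-! ### Gamma integrals in logarithmic coordinates -/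

/-- The Gamma integral after the substitution y = e^x. In this coordinate complex powers become
entire functions, and no branch of the logarithm has to be chosen. -/
theorem integrable_exp_neg_mul_exp {t s : ℝ} (ht : 0 < t) (hs : 0 < s) :
    Integrable fun x : ℝ => Real.exp (-(t * Real.exp x)) * Real.exp (s * x) := by
  have h := (integrableOn_image_iff_integrableOn_abs_deriv_smul (s := univ) (f := Real.exp)
    (f' := Real.exp) MeasurableSet.univ (fun x _ => (Real.hasDerivAt_exp x).hasDerivWithinAt)
    Real.exp_injective.injOn (fun y : ℝ => y ^ (s - 1) * Real.exp (-(t * y)))).1 (by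
      rw [image_univ, Real.range_exp]
      simpa using integrableOn_rpow_mul_exp_neg_mul_rpow (s := s - 1) (p := 1) (b := t)
        (by linarith) one_pos ht)
  rw [integrableOn_univ] at h
  refine h.congr (ae_of_all _ fun x => ?_)
  simp only [abs_of_pos (Real.exp_pos x), smul_eq_mul]
  rw [← Real.exp_mul, ← Real.exp_add, ← Real.exp_add, ← Real.exp_add]
  congr 1; ring

theorem integral_exp_neg_mul_exp {t s : ℝ} (ht : 0 < t) (hs : 0 < s) :
    ∫ x : ℝ, Real.exp (-(t * Real.exp x)) * Real.exp (s * x) = t ^ (-s) * Real.Gamma s := by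
  have h := integral_image_eq_integral_abs_deriv_smul (s := univ) (f := Real.exp)
    (f' := Real.exp) MeasurableSet.univ (fun x _ => (Real.hasDerivAt_exp x).hasDerivWithinAt)
    Real.exp_injective.injOn (fun y : ℝ => y ^ (s - 1) * Real.exp (-(t * y)))
  rw [image_univ, Real.range_exp, Real.integral_rpow_mul_exp_neg_mul_Ioi hs ht,
    setIntegral_univ] at h
  rw [Real.rpow_neg ht.le, ← Real.inv_rpow ht.le, ← one_div, h]
  refine integral_congr_ae (ae_of_all _ fun x => ?_)
  simp only [abs_of_pos (Real.exp_pos x), smul_eq_mul]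
  rw [← Real.exp_mul, ← Real.exp_add, ← Real.exp_add, ← Real.exp_add]
  congr 1; ring

/-- On a right half-line the sign of s is irrelevant, since s may be replaced by |s| + 1 at the cost
of a constant. The kernels with μ ≥ 1 need this. -/
theorem integrableOn_Ioi_exp_neg_mul_exp {t : ℝ} (ht : 0 < t) (s a : ℝ) :
    IntegrableOn (fun x : ℝ => Real.exp (-(t * Real.exp x)) * Real.exp (s * x)) (Ioi a) := by
  have h := (integrable_exp_neg_mul_exp ht (s := |s| + 1) (by positivity)).const_mul
    (Real.exp ((s - (|s| + 1)) * a))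
  refine h.integrableOn.mono' (by fun_prop) ?_
  filter_upwards [ae_restrict_mem measurableSet_Ioi] with x hx
  have hx : a < x := hx
  rw [Real.norm_of_nonneg (by positivity), mul_left_comm, ← Real.exp_add ((s - (|s| + 1)) * a)]
  refine mul_le_mul_of_nonneg_left (Real.exp_le_exp.2 ?_) (by positivity)
  have : s ≤ |s| := le_abs_self s
  nlinarith

/-! ### Hankel's formula for 1/Γ -/

/-- Half of a Hankel contour integral in logarithmic coordinates: for a function that is real on the
real axis this is the imaginary part of its integral along the boundary of
`{ζ | a ≤ re ζ, 0 ≤ im ζ ≤ π}`. -/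
noncomputable def hankel (a : ℝ) (F : ℂ → ℂ) : ℝ :=
  (∫ y in (0 : ℝ)..Real.pi, (F (a + y * Complex.I)).re) +
    ∫ x in Ioi a, (F (x + Real.pi * Complex.I)).im

/-- The closed horizontal strip `0 ≤ im ζ ≤ π`. -/
def closedStrip : Set ℂ := {ζ | ζ.im ∈ Icc 0 Real.pi}

theorem add_mul_I_mem_closedStrip {x y : ℝ} (hy : y ∈ Icc 0 Real.pi) :
    (x + y * Complex.I : ℂ) ∈ closedStrip := by
  simpa [closedStrip] using hy

theorem pi_mem_Icc : Real.pi ∈ Icc 0 Real.pi := ⟨Real.pi_pos.le, le_rfl⟩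

theorem continuous_line_of_strip {F : ℂ → ℂ} (hF : ContinuousOn F closedStrip) {y : ℝ}
    (hy : y ∈ Icc 0 Real.pi) : Continuous fun x : ℝ => F (x + y * Complex.I) :=
  hF.comp_continuous (by fun_prop) fun _ => add_mul_I_mem_closedStrip hy

theorem continuousOn_segment_of_strip {F : ℂ → ℂ} (hF : ContinuousOn F closedStrip) (x : ℝ) :
    ContinuousOn (fun y : ℝ => F (x + y * Complex.I)) (uIcc 0 Real.pi) := by
  rw [uIcc_of_le Real.pi_pos.le]
  exact hF.comp (by fun_prop) fun _ hy => add_mul_I_mem_closedStrip hy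

/-- The imaginary part of Cauchy's theorem on the rectangle [a, b] × [0, π]; the bottom side drops
out because F is real there. -/
theorem integral_re_segment_sub {F : ℂ → ℂ} (hF : DifferentiableOn ℂ F closedStrip)
    (hreal : ∀ x : ℝ, (F x).im = 0) (a b : ℝ) :
    (∫ y in (0 : ℝ)..Real.pi, (F (b + y * Complex.I)).re) -
      (∫ y in (0 : ℝ)..Real.pi, (F (a + y * Complex.I)).re) =
      ∫ x in a..b, (F (x + Real.pi * Complex.I)).im := by
  have h := Complex.integral_boundary_rect_eq_zero_of_differentiableOn F a
    (b + Real.pi * Complex.I) (hF.mono (by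
      intro z hz
      have := hz.2
      simp only [Complex.ofReal_im, Complex.add_im, Complex.mul_im, Complex.I_im, Complex.I_re,
        Complex.ofReal_re, mul_one, mul_zero, add_zero, zero_add, mem_preimage] at this
      rwa [uIcc_of_le Real.pi_pos.le] at this))
  have hc := hF.continuousOn
  have hre : ∀ x : ℝ, (∫ y in (0 : ℝ)..Real.pi, F (x + y * Complex.I)).re =
      ∫ y in (0 : ℝ)..Real.pi, (F (x + y * Complex.I)).re := fun x =>
    (Complex.reCLM.intervalIntegral_comp_comm
      (continuousOn_segment_of_strip hc x).intervalIntegrable).symm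
  have him : ∀ y ∈ Icc 0 Real.pi, (∫ x in a..b, F (x + y * Complex.I)).im =
      ∫ x in a..b, (F (x + y * Complex.I)).im := fun y hy =>
    (Complex.imCLM.intervalIntegral_comp_comm
      ((continuous_line_of_strip hc hy).intervalIntegrable _ _)).symm
  have h0 := him 0 ⟨le_rfl, Real.pi_pos.le⟩
  simp only [Complex.ofReal_zero, zero_mul, add_zero, hreal, intervalIntegral.integral_zero] at h0
  have h' := congrArg Complex.im h
  simp only [Complex.ofReal_im, Complex.add_im, Complex.mul_im, Complex.I_im, Complex.I_re,
    Complex.ofReal_re, mul_one, mul_zero, add_zero, zero_add, Complex.sub_im, Complex.add_re,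
    Complex.mul_re, Complex.ofReal_zero, zero_mul, one_mul, smul_eq_mul,
    Complex.zero_im, h0, sub_self, hre, him _ pi_mem_Icc] at h'
  linarith

/-- By Cauchy's theorem the value does not depend on the abscissa. Sending it to -∞, the segment
contributes π times the real part of the limit, and the half-line grows to the whole upper line. -/
theorem hankel_eq_of_tendsto {F : ℂ → ℂ} (hF : DifferentiableOn ℂ F closedStrip)
    (hreal : ∀ x : ℝ, (F x).im = 0)
    (hint : Integrable fun x : ℝ => (F (x + Real.pi * Complex.I)).im) {B : ℝ}
    (hB : ∀ᶠ a : ℝ in atBot, ∀ y ∈ Icc 0 Real.pi, ‖F (a + y * Complex.I)‖ ≤ B) {l : ℂ}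
    (hl : ∀ y ∈ Icc 0 Real.pi, Tendsto (fun a : ℝ => F (a + y * Complex.I)) atBot (𝓝 l)) (a : ℝ) :
    hankel a F = Real.pi * l.re + ∫ x : ℝ, (F (x + Real.pi * Complex.I)).im := by
  have hconst : ∀ b : ℝ, hankel b F = hankel a F := by
    intro b
    have h1 := integral_re_segment_sub hF hreal a b
    have h2 := intervalIntegral.integral_interval_add_Ioi' (a := a) (b := b) (μ := volume)
      (hint.intervalIntegrable) hint.integrableOn
    simp only [hankel]
    linarith
  have h1 : Tendsto (fun b : ℝ => ∫ y in (0 : ℝ)..Real.pi, (F (b + y * Complex.I)).re) atBot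
      (𝓝 (∫ _ in (0 : ℝ)..Real.pi, l.re)) := by
    refine intervalIntegral.tendsto_integral_filter_of_dominated_convergence (fun _ => B) ?_ ?_
      intervalIntegrable_const ?_
    · refine Eventually.of_forall fun b => ?_
      have := Complex.continuous_re.comp_continuousOn (continuousOn_segment_of_strip hF.continuousOn b)
      exact (this.mono uIoc_subset_uIcc).aestronglyMeasurable measurableSet_uIoc
    · filter_upwards [hB] with b hb
      refine ae_of_all _ fun y hy => ?_
      rw [uIoc_of_le Real.pi_pos.le] at hy
      exact (Complex.abs_re_le_norm _).trans (hb y ⟨hy.1.le, hy.2⟩)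
    · refine ae_of_all _ fun y hy => ?_
      rw [uIoc_of_le Real.pi_pos.le] at hy
      exact (Complex.continuous_re.tendsto l).comp (hl y ⟨hy.1.le, hy.2⟩)
  have h2 : Tendsto (fun b : ℝ => ∫ x in Ioi b, (F (x + Real.pi * Complex.I)).im) atBot
      (𝓝 (∫ x : ℝ, (F (x + Real.pi * Complex.I)).im)) :=
    (aecover_Ioi tendsto_id).integral_tendsto_of_countably_generated hint
  have h3 : Tendsto (fun b : ℝ => hankel b F) atBot (𝓝 (hankel a F)) := by
    simp only [hconst]; exact tendsto_const_nhds
  have h4 := tendsto_nhds_unique h3 (h1.add h2)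
  rw [h4]; simp

/-- The function whose Hankel integral is `2πi t^{μ-1} / Γ(μ)`. -/
noncomputable def hankelKernel (t μ : ℝ) (ζ : ℂ) : ℂ :=
  Complex.exp (t * Complex.exp ζ) * Complex.exp (((1 - μ : ℝ) : ℂ) * ζ)

theorem differentiable_hankelKernel (t μ : ℝ) : Differentiable ℂ (hankelKernel t μ) := by
  unfold hankelKernel; fun_prop

theorem hankelKernel_im (t μ x : ℝ) : (hankelKernel t μ x).im = 0 := by
  have : hankelKernel t μ x = ((Real.exp (t * Real.exp x) * Real.exp ((1 - μ) * x) : ℝ) : ℂ) := by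
    simp [hankelKernel]
  rw [this, Complex.ofReal_im]

theorem exp_add_pi_mul_I (x : ℝ) : Complex.exp (x + Real.pi * Complex.I) = -(Real.exp x : ℂ) := by
  rw [Complex.exp_add, Complex.exp_pi_mul_I]; simp

theorem exp_mul_add_mul_I (s x y : ℝ) :
    Complex.exp ((s : ℂ) * (x + y * Complex.I)) =
      (Real.exp (s * x) : ℂ) * Complex.exp (((s * y : ℝ) : ℂ) * Complex.I) := by
  rw [mul_add, Complex.exp_add]; push_cast; ring_nf

theorem hankelKernel_line_im (t μ x : ℝ) :
    (hankelKernel t μ (x + Real.pi * Complex.I)).im =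
      Real.exp (-(t * Real.exp x)) * Real.exp ((1 - μ) * x) * Real.sin ((1 - μ) * Real.pi) := by
  rw [hankelKernel, exp_add_pi_mul_I, exp_mul_add_mul_I, mul_neg, ← Complex.ofReal_mul,
    ← Complex.ofReal_neg, ← Complex.ofReal_exp, ← mul_assoc, ← Complex.ofReal_mul,
    Complex.im_ofReal_mul, Complex.exp_ofReal_mul_I_im]

theorem norm_hankelKernel (t μ x y : ℝ) :
    ‖hankelKernel t μ (x + y * Complex.I)‖ =
      Real.exp (t * (Real.exp x * Real.cos y)) * Real.exp ((1 - μ) * x) := by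
  rw [hankelKernel, norm_mul, Complex.norm_exp, Complex.norm_exp]
  simp [Complex.exp_re]

theorem integrableOn_hankelKernel_line_im {t : ℝ} (ht : 0 < t) (μ a : ℝ) :
    IntegrableOn (fun x : ℝ => (hankelKernel t μ (x + Real.pi * Complex.I)).im) (Ioi a) := by
  simp only [hankelKernel_line_im]
  exact (integrableOn_Ioi_exp_neg_mul_exp ht (1 - μ) a).mul_const _

theorem norm_hankelKernel_le {t μ x y : ℝ} (ht : 0 < t) (hμ : μ ≤ 1) (hx : x ≤ 0) :
    ‖hankelKernel t μ (x + y * Complex.I)‖ ≤ Real.exp t := by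
  rw [norm_hankelKernel, ← Real.exp_add]
  refine Real.exp_le_exp.2 ?_
  have h1 : Real.exp x ≤ 1 := Real.exp_le_one_iff.2 hx
  have h2 : Real.exp x * Real.cos y ≤ 1 :=
    (mul_le_of_le_one_right (Real.exp_pos x).le (Real.cos_le_one y)).trans h1
  nlinarith

theorem tendsto_exp_add_mul_I_atBot (y : ℝ) :
    Tendsto (fun x : ℝ => Complex.exp (x + y * Complex.I)) atBot (𝓝 0) := by
  rw [tendsto_zero_iff_norm_tendsto_zero]
  simpa [Complex.norm_exp] using Real.tendsto_exp_atBot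

theorem tendsto_exp_mul_add_mul_I_atBot {s : ℝ} (hs : 0 < s) (y : ℝ) :
    Tendsto (fun x : ℝ => Complex.exp ((s : ℂ) * (x + y * Complex.I))) atBot (𝓝 0) := by
  rw [tendsto_zero_iff_norm_tendsto_zero]
  simpa [Complex.norm_exp] using tendsto_id.const_mul_atBot hs

theorem hankel_hankelKernel_one {t : ℝ} (ht : 0 < t) (a : ℝ) :
    hankel a (hankelKernel t 1) = Real.pi := by
  have hline : ∀ x : ℝ, (hankelKernel t 1 (x + Real.pi * Complex.I)).im = 0 := fun x => by
    rw [hankelKernel_line_im]; simp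
  rw [hankel_eq_of_tendsto (differentiable_hankelKernel t 1).differentiableOn
    (hankelKernel_im t 1) (by simp [hline]) (B := Real.exp t) (l := 1)]
  · simp [hline]
  · filter_upwards [eventually_le_atBot 0] with x hx y _ using norm_hankelKernel_le ht le_rfl hx
  · intro y _
    have := (tendsto_exp_add_mul_I_atBot y).const_mul (t : ℂ)
    have := (Complex.continuous_exp.tendsto _).comp this
    simpa [hankelKernel, Function.comp_def] using this

/-- Here 1 - μ > 0, so the kernel vanishes at -∞ and only the line im ζ = π remains. It yields
t^(μ-1) Γ(1-μ) sin(πμ), and the reflection formula finishes. -/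
theorem hankel_hankelKernel_of_lt_one {t μ : ℝ} (ht : 0 < t) (hμ0 : 0 < μ) (hμ : μ < 1) (a : ℝ) :
    hankel a (hankelKernel t μ) = Real.pi * (t ^ (μ - 1) / Real.Gamma μ) := by
  have h1μ : 0 < 1 - μ := by linarith
  have hint : Integrable fun x : ℝ => (hankelKernel t μ (x + Real.pi * Complex.I)).im := by
    simp only [hankelKernel_line_im]
    exact (integrable_exp_neg_mul_exp ht h1μ).mul_const _
  rw [hankel_eq_of_tendsto (differentiable_hankelKernel t μ).differentiableOn
    (hankelKernel_im t μ) hint (B := Real.exp t) (l := 0)]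
  · simp only [hankelKernel_line_im]
    rw [integral_mul_const, integral_exp_neg_mul_exp ht h1μ]
    have h := Real.Gamma_mul_Gamma_one_sub μ
    have hs : 0 < Real.sin (Real.pi * μ) :=
      Real.sin_pos_of_pos_of_lt_pi (by positivity) (by nlinarith [Real.pi_pos])
    have hs' : Real.sin ((1 - μ) * Real.pi) = Real.sin (Real.pi * μ) := by
      rw [← Real.sin_pi_sub]; ring_nf
    have hG := Real.Gamma_pos_of_pos hμ0
    rw [hs', neg_sub, Complex.zero_re, mul_zero, zero_add]
    rw [eq_div_iff hs.ne'] at h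
    rw [mul_div_assoc', eq_div_iff hG.ne']
    linear_combination t ^ (μ - 1) * h
  · filter_upwards [eventually_le_atBot 0] with x hx y _ using norm_hankelKernel_le ht hμ.le hx
  · intro y _
    have h1 := (Complex.continuous_exp.tendsto _).comp
      ((tendsto_exp_add_mul_I_atBot y).const_mul (t : ℂ))
    have := h1.mul (tendsto_exp_mul_add_mul_I_atBot h1μ y)
    simpa [hankelKernel, Function.comp_def] using this

theorem tendsto_exp_neg_mul_exp_atTop {t : ℝ} (ht : 0 < t) (s : ℝ) :
    Tendsto (fun x : ℝ => Real.exp (-(t * Real.exp x)) * Real.exp (s * x)) atTop (𝓝 0) := by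
  have h := (tendsto_rpow_mul_exp_neg_mul_atTop_nhds_zero s t ht).comp Real.tendsto_exp_atTop
  refine h.congr fun x => ?_
  simp only [Function.comp_apply]
  rw [← Real.exp_mul, mul_comm, mul_comm x s, neg_mul]

theorem hasDerivAt_hankelKernel (t μ : ℝ) (ζ : ℂ) :
    HasDerivAt (hankelKernel t (μ + 1))
      (t * hankelKernel t μ ζ - μ * hankelKernel t (μ + 1) ζ) ζ := by
  have h1 : HasDerivAt (fun ζ : ℂ => Complex.exp (t * Complex.exp ζ)) _ ζ :=
    ((Complex.hasDerivAt_exp ζ).const_mul (t : ℂ)).cexp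
  have h2 : HasDerivAt (fun ζ : ℂ => Complex.exp (((1 - (μ + 1) : ℝ) : ℂ) * ζ)) _ ζ :=
    ((hasDerivAt_id ζ).const_mul _).cexp
  refine (h1.mul h2).congr_deriv ?_
  have h3 : Complex.exp (((1 - μ : ℝ) : ℂ) * ζ) =
      Complex.exp ζ * Complex.exp (((1 - (μ + 1) : ℝ) : ℂ) * ζ) := by
    rw [← Complex.exp_add]; push_cast; ring_nf
  simp only [hankelKernel, h3]
  push_cast
  simp only [id]
  ring

/-- The functional equation of Gamma, obtained by integrating the exact derivative in
`hasDerivAt_hankelKernel` along the contour. The values at the corner a + πi cancel; at the real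
point a the imaginary part is zero, and at infinity the kernel decays. -/
theorem hankel_hankelKernel_add_one {t : ℝ} (ht : 0 < t) (μ a : ℝ) :
    μ * hankel a (hankelKernel t (μ + 1)) = t * hankel a (hankelKernel t μ) := by
  set G := hankelKernel t (μ + 1)
  set F := hankelKernel t μ
  have hc : ∀ ν, Continuous (hankelKernel t ν) := fun ν => (differentiable_hankelKernel t ν).continuous
  have h1 : ∫ y in (0 : ℝ)..Real.pi,
      (t * (F (a + y * Complex.I)).re - μ * (G (a + y * Complex.I)).re) =
      (G (a + Real.pi * Complex.I)).im := by
    have hd : ∀ y : ℝ, HasDerivAt (fun y : ℝ => (G (a + y * Complex.I)).im)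
        (t * (F (a + y * Complex.I)).re - μ * (G (a + y * Complex.I)).re) y := by
      intro y
      have hi : HasDerivAt (fun z : ℂ => (a : ℂ) + z * Complex.I) Complex.I (y : ℂ) := by
        simpa using ((hasDerivAt_id (y : ℂ)).mul_const Complex.I).const_add (a : ℂ)
      have h := (hasDerivAt_hankelKernel t μ (a + y * Complex.I)).comp (y : ℂ) hi
      have h := h.comp_ofReal
      have := (Complex.imCLM.hasFDerivAt.comp_hasDerivAt y h)
      refine this.congr_deriv ?_
      simp [F, G]
    rw [intervalIntegral.integral_eq_sub_of_hasDerivAt (fun y _ => hd y)]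
    · have : (G (a + (0 : ℝ) * Complex.I)).im = 0 := by
        simpa using hankelKernel_im t (μ + 1) a
      rw [this, sub_zero]
    · apply Continuous.intervalIntegrable
      have := hc μ; have := hc (μ + 1)
      fun_prop
  have hFi := integrableOn_hankelKernel_line_im ht μ a
  have hGi := integrableOn_hankelKernel_line_im ht (μ + 1) a
  have h2 : ∫ x in Ioi a,
      (t * (F (x + Real.pi * Complex.I)).im - μ * (G (x + Real.pi * Complex.I)).im) =
      0 - (G (a + Real.pi * Complex.I)).im := by
    refine integral_Ioi_of_hasDerivAt_of_tendsto' (f := fun x : ℝ => (G (x + Real.pi * Complex.I)).im)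
      (fun x _ => ?_) ((hFi.const_mul t).sub (hGi.const_mul μ)) ?_
    · have hi : HasDerivAt (fun z : ℂ => z + (Real.pi : ℂ) * Complex.I) 1 (x : ℂ) :=
        (hasDerivAt_id (x : ℂ)).add_const _
      have h := ((hasDerivAt_hankelKernel t μ (x + Real.pi * Complex.I)).comp (x : ℂ) hi).comp_ofReal
      refine (Complex.imCLM.hasFDerivAt.comp_hasDerivAt x h).congr_deriv ?_
      simp [F, G]
    · simp only [G, hankelKernel_line_im]
      simpa using (tendsto_exp_neg_mul_exp_atTop ht (1 - (μ + 1))).mul_const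
        (Real.sin ((1 - (μ + 1)) * Real.pi))
  have hcF := hc μ
  have hcG := hc (μ + 1)
  rw [intervalIntegral.integral_sub (by apply Continuous.intervalIntegrable; fun_prop)
    (by apply Continuous.intervalIntegrable; fun_prop),
    intervalIntegral.integral_const_mul, intervalIntegral.integral_const_mul] at h1
  rw [integral_sub (hFi.const_mul t) (hGi.const_mul μ), integral_const_mul, integral_const_mul] at h2
  simp only [hankel]
  linarith

/-- The functional equation propagates the formula upward from 0 < μ ≤ 1. -/
theorem hankel_hankelKernel {t μ : ℝ} (ht : 0 < t) (hμ : 0 < μ) (a : ℝ) :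
    hankel a (hankelKernel t μ) = Real.pi * (t ^ (μ - 1) / Real.Gamma μ) := by
  have key : ∀ n : ℕ, ∀ μ : ℝ, 0 < μ → μ ≤ n + 1 →
      hankel a (hankelKernel t μ) = Real.pi * (t ^ (μ - 1) / Real.Gamma μ) := by
    intro n
    induction n with
    | zero =>
      intro μ hμ hμ1
      rcases lt_or_eq_of_le hμ1 with h | h
      · exact hankel_hankelKernel_of_lt_one ht hμ (by simpa using h) a
      · have : μ = 1 := by simpa using h
        subst this
        simp [hankel_hankelKernel_one ht]
    | succ n ih =>
      intro μ hμ hμ1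
      rcases le_or_gt μ 1 with h | h
      · exact ih μ hμ (by have : (0 : ℝ) ≤ n := Nat.cast_nonneg n
                          linarith)
      · have hμ' : 0 < μ - 1 := by linarith
        have h1 := ih (μ - 1) hμ' (by push_cast at hμ1; linarith)
        have h2 := hankel_hankelKernel_add_one ht (μ - 1) a
        rw [sub_add_cancel, h1] at h2
        have h3 := Real.Gamma_add_one hμ'.ne'
        rw [sub_add_cancel] at h3
        have hG := Real.Gamma_pos_of_pos hμ'
        have h4 : t ^ (μ - 1) = t * t ^ (μ - 1 - 1) := by
          rw [Real.rpow_sub_one ht.ne' (μ - 1)]; field_simp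
        rw [h3, h4]
        field_simp
        field_simp at h2
        linarith
  obtain ⟨n, hn⟩ := exists_nat_ge μ
  exact key n μ hμ (by linarith)

/-! ### The resolvent kernel and the integral representation -/

theorem intervalIntegral_nonneg_of_forall_Ioc {f : ℝ → ℝ} {a b : ℝ} (hab : a ≤ b)
    (hf : ∀ x ∈ Ioc a b, 0 ≤ f x) : 0 ≤ ∫ x in a..b, f x := by
  rw [intervalIntegral.integral_of_le hab]
  exact setIntegral_nonneg measurableSet_Ioc hf

/-- The distance from -λ to the line through 0 in direction e^(iφ): the squared norm equals (λ sin
φ)² + (r + λ cos φ)². -/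
theorem mul_sin_le_norm_add {r φ lam : ℝ} :
    lam * Real.sin φ ≤ ‖(r : ℂ) * Complex.exp ((φ : ℂ) * Complex.I) + lam‖ := by
  have h2 : (lam * Real.sin φ) ^ 2 ≤ ‖(r : ℂ) * Complex.exp ((φ : ℂ) * Complex.I) + lam‖ ^ 2 := by
    rw [← Complex.normSq_eq_norm_sq, Complex.normSq_apply]
    simp only [Complex.add_re, Complex.add_im, Complex.re_ofReal_mul, Complex.im_ofReal_mul,
      Complex.exp_ofReal_mul_I_re, Complex.exp_ofReal_mul_I_im, Complex.ofReal_re, Complex.ofReal_im]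
    have e : (r * Real.cos φ + lam) * (r * Real.cos φ + lam) +
        (r * Real.sin φ + 0) * (r * Real.sin φ + 0) =
        (lam * Real.sin φ) ^ 2 + (r + lam * Real.cos φ) ^ 2 := by
      linear_combination (r ^ 2 - lam ^ 2) * Real.sin_sq_add_cos_sq φ
    rw [e]
    exact le_add_of_nonneg_right (sq_nonneg _)
  exact abs_le_of_sq_le_sq' h2 (norm_nonneg _) |>.2

/-- The integrand `e^{st} / (s^ρ + λ) ds` in the coordinate `s = e^ζ`. -/
noncomputable def resolventKernel (t ρ lam : ℝ) (ζ : ℂ) : ℂ :=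
  Complex.exp (t * Complex.exp ζ) * Complex.exp ζ / (Complex.exp (ρ * ζ) + lam)

/-- For ρ < 1 the argument ρ im ζ stays in [0, π), so e^(ρζ) is never a negative real number. This
is where ρ = 1 is excluded. -/
theorem exp_mul_add_ne_zero {ρ lam : ℝ} (hρ : 0 < ρ) (hρ1 : ρ < 1) (hlam : 0 < lam) {ζ : ℂ}
    (hζ : ζ ∈ closedStrip) : Complex.exp (ρ * ζ) + lam ≠ 0 := by
  intro h
  have h0 : 0 ≤ ζ.im := hζ.1
  have h1 : ζ.im ≤ Real.pi := hζ.2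
  have him := congrArg Complex.im h
  have hre := congrArg Complex.re h
  simp only [Complex.add_im, Complex.add_re, Complex.exp_im, Complex.exp_re, Complex.re_ofReal_mul,
    Complex.im_ofReal_mul, Complex.ofReal_im, Complex.ofReal_re, add_zero, Complex.zero_im,
    Complex.zero_re] at him hre
  have hE := Real.exp_pos (ρ * ζ.re)
  rcases h0.eq_or_lt with h' | h'
  · rw [← h'] at hre; simp at hre; linarith
  · have : 0 < Real.sin (ρ * ζ.im) :=
      Real.sin_pos_of_pos_of_lt_pi (by positivity) (by nlinarith)
    have := mul_pos hE this
    linarith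

theorem differentiableOn_resolventKernel {t ρ lam : ℝ} (hρ : 0 < ρ) (hρ1 : ρ < 1)
    (hlam : 0 < lam) : DifferentiableOn ℂ (resolventKernel t ρ lam) closedStrip := by
  unfold resolventKernel
  exact DifferentiableOn.div (by fun_prop) (by fun_prop)
    fun ζ hζ => exp_mul_add_ne_zero hρ hρ1 hlam hζ

theorem resolventKernel_im (t ρ lam x : ℝ) : (resolventKernel t ρ lam x).im = 0 := by
  have : resolventKernel t ρ lam x =
      ((Real.exp (t * Real.exp x) * Real.exp x / (Real.exp (ρ * x) + lam) : ℝ) : ℂ) := by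
    simp [resolventKernel]
  rw [this, Complex.ofReal_im]

theorem resolventKernel_line_im (t ρ lam x : ℝ) :
    (resolventKernel t ρ lam (x + Real.pi * Complex.I)).im =
      Real.exp (-(t * Real.exp x)) * Real.exp ((1 + ρ) * x) * Real.sin (ρ * Real.pi) /
        ‖(Real.exp (ρ * x) : ℂ) * Complex.exp (((ρ * Real.pi : ℝ) : ℂ) * Complex.I) + lam‖ ^ 2 := by
  rw [resolventKernel, exp_mul_add_mul_I, exp_add_pi_mul_I]
  have h1 : Complex.exp (t * -(Real.exp x : ℂ)) * -(Real.exp x : ℂ) =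
      ((-(Real.exp (-(t * Real.exp x)) * Real.exp x) : ℝ) : ℂ) := by
    push_cast; rw [mul_neg, mul_neg]
  rw [h1, div_eq_mul_inv, Complex.im_ofReal_mul, Complex.inv_im, Complex.normSq_eq_norm_sq]
  simp only [Complex.add_im, Complex.im_ofReal_mul, Complex.exp_ofReal_mul_I_im, Complex.ofReal_im,
    add_zero]
  rw [show (1 + ρ) * x = x + ρ * x by ring, Real.exp_add]
  ring

theorem norm_resolventKernel_line_le {t ρ lam : ℝ} (hρ : 0 < ρ) (hρ1 : ρ < 1) (hlam : 0 < lam)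
    (x : ℝ) : ‖resolventKernel t ρ lam (x + Real.pi * Complex.I)‖ ≤
      Real.exp (-(t * Real.exp x)) * Real.exp (1 * x) * (lam * Real.sin (ρ * Real.pi))⁻¹ := by
  have hs : 0 < Real.sin (ρ * Real.pi) :=
    Real.sin_pos_of_pos_of_lt_pi (by positivity) (by nlinarith [Real.pi_pos])
  rw [resolventKernel, exp_mul_add_mul_I, exp_add_pi_mul_I, norm_div, norm_mul, Complex.norm_exp,
    norm_neg, Complex.norm_real, Real.norm_of_nonneg (Real.exp_pos x).le, div_eq_mul_inv, one_mul]
  refine mul_le_mul (le_of_eq ?_) (inv_anti₀ (by positivity) mul_sin_le_norm_add)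
    (by positivity) (by positivity)
  congr 2
  rw [mul_neg, ← Complex.ofReal_mul, ← Complex.ofReal_neg, Complex.ofReal_re]

theorem integrable_resolventKernel_line {t ρ lam : ℝ} (ht : 0 < t) (hρ : 0 < ρ) (hρ1 : ρ < 1)
    (hlam : 0 < lam) :
    Integrable fun x : ℝ => resolventKernel t ρ lam (x + Real.pi * Complex.I) :=
  ((integrable_exp_neg_mul_exp ht one_pos).mul_const _).mono'
    (continuous_line_of_strip (differentiableOn_resolventKernel hρ hρ1 hlam).continuousOn
      pi_mem_Icc).aestronglyMeasurable
    (ae_of_all _ (norm_resolventKernel_line_le hρ hρ1 hlam))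

/-- Unlike the single kernels with μ > 1, this one tends to 0 at -∞, because the denominator tends
to λ ≠ 0. The contour can therefore be collapsed onto the upper line. -/
theorem hankel_resolventKernel {t ρ lam : ℝ} (ht : 0 < t) (hρ : 0 < ρ) (hρ1 : ρ < 1)
    (hlam : 0 < lam) (a : ℝ) :
    hankel a (resolventKernel t ρ lam) =
      ∫ x : ℝ, (resolventKernel t ρ lam (x + Real.pi * Complex.I)).im := by
  rw [hankel_eq_of_tendsto (differentiableOn_resolventKernel hρ hρ1 hlam)
    (resolventKernel_im t ρ lam)
    (Complex.imCLM.integrable_comp (integrable_resolventKernel_line ht hρ hρ1 hlam))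
    (B := Real.exp t / (lam / 2)) (l := 0)]
  · simp
  · have h1 : ∀ᶠ x : ℝ in atBot, Real.exp (ρ * x) < lam / 2 :=
      (Real.tendsto_exp_atBot.comp (tendsto_id.const_mul_atBot hρ)).eventually_lt_const
        (by positivity)
    filter_upwards [eventually_le_atBot 0, h1] with x hx hx1 y _
    have hnum := norm_hankelKernel_le (y := y) ht zero_le_one hx
    simp only [hankelKernel, sub_zero, Complex.ofReal_one, one_mul] at hnum
    rw [resolventKernel, norm_div]
    refine div_le_div₀ (by positivity) hnum (by positivity) ?_
    have h2 := norm_sub_norm_le (lam : ℂ) (-Complex.exp (ρ * (x + y * Complex.I)))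
    have h3 : ‖Complex.exp (ρ * (x + y * Complex.I))‖ = Real.exp (ρ * x) := by
      simp [Complex.norm_exp]
    rw [norm_neg, h3, sub_neg_eq_add, add_comm (lam : ℂ), Complex.norm_real,
      Real.norm_of_nonneg hlam.le] at h2
    linarith
  · intro y _
    have h1 := tendsto_exp_add_mul_I_atBot y
    have h2 := (Complex.continuous_exp.tendsto _).comp (h1.const_mul (t : ℂ))
    have h3 := (tendsto_exp_mul_add_mul_I_atBot hρ y).add_const (lam : ℂ)
    have := (h2.mul h1).div h3 (by simpa using hlam.ne')
    simpa [resolventKernel, Function.comp_def, Pi.div_def] using this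

/-- The geometric expansion of 1/(w + λ) in powers of λ/w, valid where |w| > λ. This forces the
contour to start far to the right. -/
theorem hasSum_hankelKernel {t ρ lam : ℝ} (hlam : 0 < lam) {x : ℝ} (hx : lam < Real.exp (ρ * x))
    (y : ℝ) :
    HasSum (fun k : ℕ => ((-lam : ℝ) : ℂ) ^ k * hankelKernel t (ρ * k + ρ) (x + y * Complex.I))
      (resolventKernel t ρ lam (x + y * Complex.I)) := by
  set ζ : ℂ := x + y * Complex.I
  set w := Complex.exp (ρ * ζ) with hw
  have hw0 : w ≠ 0 := Complex.exp_ne_zero _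
  have hnorm : ‖w‖ = Real.exp (ρ * x) := by simp [w, ζ, Complex.norm_exp]
  have hq : ‖((-lam : ℝ) : ℂ) * w⁻¹‖ < 1 := by
    rw [norm_mul, norm_inv, hnorm, Complex.norm_real, norm_neg, Real.norm_of_nonneg hlam.le,
      ← div_eq_mul_inv, div_lt_one (Real.exp_pos _)]
    exact hx
  have h := (hasSum_geometric_of_norm_lt_one hq).mul_left
    (Complex.exp (t * Complex.exp ζ) * Complex.exp ζ * w⁻¹)
  have hterm : ∀ k : ℕ, ((-lam : ℝ) : ℂ) ^ k * hankelKernel t (ρ * k + ρ) ζ =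
      Complex.exp (t * Complex.exp ζ) * Complex.exp ζ * w⁻¹ * (((-lam : ℝ) : ℂ) * w⁻¹) ^ k := by
    intro k
    have hk : Complex.exp (((1 - (ρ * (k : ℝ) + ρ) : ℝ) : ℂ) * ζ) = Complex.exp ζ * w⁻¹ * (w⁻¹) ^ k := by
      rw [hw, ← Complex.exp_neg, ← Complex.exp_nat_mul, ← Complex.exp_add, ← Complex.exp_add]
      push_cast; ring_nf
    unfold hankelKernel
    rw [hk, mul_pow]; ring
  have hval : resolventKernel t ρ lam ζ =
      Complex.exp (t * Complex.exp ζ) * Complex.exp ζ * w⁻¹ *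
        (1 - ((-lam : ℝ) : ℂ) * w⁻¹)⁻¹ := by
    have hne : w + lam ≠ 0 := by
      intro h0
      have h1 : w = -(lam : ℂ) := eq_neg_of_add_eq_zero_left h0
      have h2 := hnorm
      rw [h1, norm_neg, Complex.norm_real, Real.norm_of_nonneg hlam.le] at h2
      linarith
    unfold resolventKernel
    rw [← hw]
    have : 1 - ((-lam : ℝ) : ℂ) * w⁻¹ = (w + lam) * w⁻¹ := by
      rw [add_mul, mul_inv_cancel₀ hw0]; push_cast; ring
    rw [this, mul_inv, inv_inv, div_eq_mul_inv]
    field_simp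
  simp_rw [hterm, hval]
  exact h

theorem norm_hankelKernel_term_le {t ρ lam : ℝ} (hρ : 0 < ρ) (hlam : 0 < lam) {a x : ℝ}
    (hax : a ≤ x) (y : ℝ) (k : ℕ) :
    ‖((-lam : ℝ) : ℂ) ^ k * hankelKernel t (ρ * k + ρ) (x + y * Complex.I)‖ ≤
      Real.exp (t * (Real.exp x * Real.cos y)) * Real.exp ((1 - ρ) * x) *
        (lam * Real.exp (-(ρ * a))) ^ k := by
  rw [norm_mul, norm_pow, norm_hankelKernel, Complex.norm_real, norm_neg,
    Real.norm_of_nonneg hlam.le, mul_pow, ← Real.exp_nat_mul]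
  have : Real.exp ((1 - (ρ * k + ρ)) * x) ≤
      Real.exp ((1 - ρ) * x) * Real.exp (k * -(ρ * a)) := by
    rw [← Real.exp_add]
    refine Real.exp_le_exp.2 ?_
    have := mul_le_mul_of_nonneg_left hax (show 0 ≤ (k : ℝ) * ρ by positivity)
    nlinarith
  calc lam ^ k * (Real.exp (t * (Real.exp x * Real.cos y)) * Real.exp ((1 - (ρ * k + ρ)) * x))
      ≤ lam ^ k * (Real.exp (t * (Real.exp x * Real.cos y)) *
        (Real.exp ((1 - ρ) * x) * Real.exp (k * -(ρ * a)))) := by gcongr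
    _ = _ := by ring

theorem hasSum_hankel_hankelKernel {t ρ lam : ℝ} (ht : 0 < t) (hρ : 0 < ρ)
    (hlam : 0 < lam) {a : ℝ} (ha : lam < Real.exp (ρ * a)) :
    HasSum (fun k : ℕ => (-lam) ^ k * hankel a (hankelKernel t (ρ * k + ρ)))
      (hankel a (resolventKernel t ρ lam)) := by
  set q := lam * Real.exp (-(ρ * a)) with hq
  have hq0 : 0 ≤ q := by positivity
  have hq1 : q < 1 := by
    rw [hq, Real.exp_neg, ← div_eq_mul_inv, div_lt_one (Real.exp_pos _)]
    exact ha
  have hax : ∀ x, a ≤ x → lam < Real.exp (ρ * x) := fun x hx =>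
    ha.trans_le (Real.exp_le_exp.2 (mul_le_mul_of_nonneg_left hx hρ.le))
  have hgeo := summable_geometric_of_lt_one hq0 hq1
  have hcast : ∀ k : ℕ, ((-lam : ℝ) : ℂ) ^ k = (((-lam) ^ k : ℝ) : ℂ) := fun k => by push_cast; rfl
  have hre : ∀ (k : ℕ) (z : ℂ), (-lam) ^ k * z.re = (((-lam : ℝ) : ℂ) ^ k * z).re := fun k z => by
    rw [hcast, Complex.re_ofReal_mul]
  have him : ∀ (k : ℕ) (z : ℂ), (-lam) ^ k * z.im = (((-lam : ℝ) : ℂ) ^ k * z).im := fun k z => by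
    rw [hcast, Complex.im_ofReal_mul]
  have hcont : ∀ μ : ℝ, Continuous (hankelKernel t μ) := fun μ =>
    (differentiable_hankelKernel t μ).continuous
  have hs1 : HasSum (fun k : ℕ => ∫ y in (0 : ℝ)..Real.pi,
      (-lam) ^ k * (hankelKernel t (ρ * k + ρ) (a + y * Complex.I)).re)
      (∫ y in (0 : ℝ)..Real.pi, (resolventKernel t ρ lam (a + y * Complex.I)).re) := by
    refine intervalIntegral.hasSum_integral_of_dominated_convergence
      (fun k y => Real.exp (t * (Real.exp a * Real.cos y)) * Real.exp ((1 - ρ) * a) * q ^ k)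
      (fun k => ?_) (fun k => ae_of_all _ fun y _ => ?_) (ae_of_all _ fun y _ => hgeo.mul_left _) ?_
      (ae_of_all _ fun y _ => ?_)
    · have := hcont (ρ * k + ρ)
      exact Continuous.aestronglyMeasurable (by fun_prop)
    · rw [hre]
      exact (Complex.abs_re_le_norm _).trans (norm_hankelKernel_term_le hρ hlam le_rfl y k)
    · simp_rw [tsum_mul_left]
      exact Continuous.intervalIntegrable (by fun_prop) _ _
    · simp_rw [hre]
      exact Complex.reCLM.hasSum (hasSum_hankelKernel hlam ha y)
  have hs2 : HasSum (fun k : ℕ => ∫ x in Ioi a,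
      (-lam) ^ k * (hankelKernel t (ρ * k + ρ) (x + Real.pi * Complex.I)).im)
      (∫ x in Ioi a, (resolventKernel t ρ lam (x + Real.pi * Complex.I)).im) := by
    refine hasSum_integral_of_dominated_convergence
      (fun k x => Real.exp (t * (Real.exp x * Real.cos Real.pi)) * Real.exp ((1 - ρ) * x) * q ^ k)
      (fun k => ?_) (fun k => ?_) (ae_of_all _ fun y => hgeo.mul_left _) ?_ ?_
    · have := hcont (ρ * k + ρ)
      exact Continuous.aestronglyMeasurable (by fun_prop)
    · filter_upwards [ae_restrict_mem measurableSet_Ioi] with x hx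
      rw [him]
      exact (Complex.abs_im_le_norm _).trans
        (norm_hankelKernel_term_le hρ hlam (le_of_lt hx) Real.pi k)
    · simp_rw [tsum_mul_left]
      have := (integrableOn_Ioi_exp_neg_mul_exp ht (1 - ρ) a).mul_const (∑' k : ℕ, q ^ k)
      simpa [IntegrableOn] using this
    · filter_upwards [ae_restrict_mem measurableSet_Ioi] with x hx
      simp_rw [him]
      exact Complex.imCLM.hasSum (hasSum_hankelKernel hlam (hax x (le_of_lt hx)) Real.pi)
  have h := hs1.add hs2
  simp_rw [intervalIntegral.integral_const_mul, integral_const_mul, ← mul_add] at h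
  exact h

/-- One contour integral is evaluated twice: as a series far to the right of the point where e^(ρa)
= λ, and on the upper line after the contour is collapsed. -/
theorem pi_mul_relaxation_eq_integral {t ρ lam : ℝ} (ht : 0 < t) (hρ : 0 < ρ) (hρ1 : ρ < 1)
    (hlam : 0 < lam) :
    Real.pi * relaxation lam ρ ρ t =
      ∫ x : ℝ, (resolventKernel t ρ lam (x + Real.pi * Complex.I)).im := by
  obtain ⟨a, ha⟩ : ∃ a : ℝ, lam < Real.exp (ρ * a) := by
    refine ⟨(Real.log lam + 1) / ρ, ?_⟩
    rw [mul_div_cancel₀ _ hρ.ne', ← Real.log_lt_iff_lt_exp hlam]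
    linarith
  rw [← hankel_resolventKernel ht hρ hρ1 hlam a]
  have h1 := hasSum_hankel_hankelKernel ht hρ hlam ha
  have h2 := (hasSum_relaxation (lam := lam) hρ hρ ht).mul_left Real.pi
  refine h2.unique (h1.congr_fun ?_)
  intro k
  rw [hankel_hankelKernel ht (by positivity)]
  ring

/-! ### Positivity, monotonicity in time and bounds -/

theorem resolventKernel_line_im_pos {t ρ lam : ℝ} (hρ : 0 < ρ) (hρ1 : ρ < 1) (hlam : 0 < lam)
    (x : ℝ) : 0 < (resolventKernel t ρ lam (x + Real.pi * Complex.I)).im := by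
  have hs : 0 < Real.sin (ρ * Real.pi) :=
    Real.sin_pos_of_pos_of_lt_pi (by positivity) (by nlinarith [Real.pi_pos])
  have h := mul_sin_le_norm_add (r := Real.exp (ρ * x)) (φ := ρ * Real.pi) (lam := lam)
  have hn := (mul_pos hlam hs).trans_le h
  rw [resolventKernel_line_im]
  positivity

theorem relaxation_pos {lam ρ t : ℝ} (hlam : 0 < lam) (hρ : 0 < ρ) (hρ1 : ρ ≤ 1) (ht : 0 < t) :
    0 < relaxation lam ρ ρ t := by
  rcases hρ1.lt_or_eq with h | rfl
  · refine pos_of_mul_pos_right (a := Real.pi) ?_ Real.pi_pos.le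
    rw [pi_mul_relaxation_eq_integral ht hρ h hlam,
      integral_pos_iff_support_of_nonneg (fun x => (resolventKernel_line_im_pos hρ h hlam x).le)
        (Complex.imCLM.integrable_comp (integrable_resolventKernel_line ht hρ h hlam))]
    have : Function.support (fun x : ℝ =>
        (resolventKernel t ρ lam (x + Real.pi * Complex.I)).im) = univ :=
      eq_univ_of_forall fun x => (resolventKernel_line_im_pos hρ h hlam x).ne'
    rw [this]; simp
  · rw [relaxation_one_one]; exact Real.exp_pos _

/-- In the integral representation t enters only through the factor exp(-t e^x), multiplied by
positive quantities. -/
theorem relaxation_antitoneOn {lam ρ : ℝ} (hlam : 0 < lam) (hρ : 0 < ρ) (hρ1 : ρ ≤ 1) :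
    AntitoneOn (relaxation lam ρ ρ) (Ioi 0) := by
  intro s hs t ht hst
  rcases hρ1.lt_or_eq with h | rfl
  · refine le_of_mul_le_mul_left ?_ Real.pi_pos
    rw [pi_mul_relaxation_eq_integral ht hρ h hlam, pi_mul_relaxation_eq_integral hs hρ h hlam]
    refine integral_mono
      (Complex.imCLM.integrable_comp (integrable_resolventKernel_line ht hρ h hlam))
      (Complex.imCLM.integrable_comp (integrable_resolventKernel_line hs hρ h hlam)) fun x => ?_
    have hsin : 0 < Real.sin (ρ * Real.pi) :=
      Real.sin_pos_of_pos_of_lt_pi (by positivity) (by nlinarith [Real.pi_pos])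
    simp only [resolventKernel_line_im]
    gcongr
  · rw [relaxation_one_one, relaxation_one_one]
    exact Real.exp_le_exp.2 (by nlinarith)

/-- For ρ < 1 this is, up to a positive factor, the fractional integral of order 1 - ρ of a positive
function. -/
theorem relaxation_one_nonneg {lam ρ t : ℝ} (hlam : 0 < lam) (hρ : 0 < ρ) (hρ1 : ρ ≤ 1)
    (ht : 0 < t) : 0 ≤ relaxation lam ρ 1 t := by
  rcases hρ1.lt_or_eq with h | rfl
  · have ha : 0 < 1 - ρ := by linarith
    have h1 := integral_rpow_mul_relaxation (lam := lam) hρ hρ ha ht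
    rw [add_sub_cancel] at h1
    refine nonneg_of_mul_nonneg_right (a := Real.Gamma (1 - ρ)) ?_ (Real.Gamma_pos_of_pos ha)
    rw [← h1]
    refine intervalIntegral_nonneg_of_forall_Ioc ht.le fun x hx => ?_
    exact mul_nonneg (Real.rpow_nonneg (by linarith [hx.2]) _) (relaxation_pos hlam hρ hρ1 hx.1).le
  · rw [relaxation_one_one]; positivity

theorem relaxation_one_eq {lam ρ t : ℝ} (hρ : 0 < ρ) (ht : 0 < t) :
    relaxation lam ρ 1 t = 1 - lam * ∫ ξ in (0 : ℝ)..t, relaxation lam ρ ρ ξ := by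
  rw [integral_relaxation hρ hρ ht, relaxation_eq_sub hρ one_pos ht]
  simp [add_comm]

theorem integral_relaxation_nonneg {lam ρ t : ℝ} (hlam : 0 < lam) (hρ : 0 < ρ) (hρ1 : ρ ≤ 1)
    (ht : 0 < t) : 0 ≤ ∫ ξ in (0 : ℝ)..t, relaxation lam ρ ρ ξ :=
  intervalIntegral_nonneg_of_forall_Ioc ht.le fun _ hx =>
    (relaxation_pos hlam hρ hρ1 hx.1).le

theorem relaxation_one_le_one {lam ρ t : ℝ} (hlam : 0 < lam) (hρ : 0 < ρ) (hρ1 : ρ ≤ 1)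
    (ht : 0 < t) : relaxation lam ρ 1 t ≤ 1 := by
  rw [relaxation_one_eq hρ ht]
  have := mul_nonneg hlam.le (integral_relaxation_nonneg hlam hρ hρ1 ht)
  linarith

/-- Monotonicity gives t e(t) ≤ ∫₀ᵗ e, and the integral is at most 1/λ because 1 - λ ∫₀ᵗ e ≥ 0. The
bound is uniform in λ, so it controls A u. -/
theorem mul_relaxation_le_inv {lam ρ t : ℝ} (hlam : 0 < lam) (hρ : 0 < ρ) (hρ1 : ρ ≤ 1)
    (ht : 0 < t) : lam * relaxation lam ρ ρ t ≤ t⁻¹ := by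
  have h1 := relaxation_one_nonneg hlam hρ hρ1 ht
  rw [relaxation_one_eq hρ ht] at h1
  have h2 : t * relaxation lam ρ ρ t ≤ ∫ ξ in (0 : ℝ)..t, relaxation lam ρ ρ ξ := by
    have : ∫ _ in (0 : ℝ)..t, relaxation lam ρ ρ t = t * relaxation lam ρ ρ t := by simp
    rw [← this]
    refine intervalIntegral.integral_mono_on_of_le_Ioo ht.le intervalIntegrable_const
      (intervalIntegrable_relaxation hρ hρ ht) fun x hx => ?_
    exact relaxation_antitoneOn hlam hρ hρ1 hx.1 ht hx.2.le
  rw [← one_div, le_div_iff₀ ht]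
  nlinarith

/-- The correction to the first term of the series is -λ times a fractional integral of a positive
function, up to a positive factor. -/
theorem relaxation_le_rpow {lam ρ t : ℝ} (hlam : 0 < lam) (hρ : 0 < ρ) (hρ1 : ρ ≤ 1)
    (ht : 0 < t) : relaxation lam ρ ρ t ≤ t ^ (ρ - 1) / Real.Gamma ρ := by
  rw [relaxation_eq_sub hρ hρ ht]
  have h1 := integral_rpow_mul_relaxation (lam := lam) hρ hρ hρ ht
  have h2 : 0 ≤ relaxation lam ρ (ρ + ρ) t := by
    refine nonneg_of_mul_nonneg_right (a := Real.Gamma ρ) ?_ (Real.Gamma_pos_of_pos hρ)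
    rw [← h1]
    refine intervalIntegral_nonneg_of_forall_Ioc ht.le fun x hx => ?_
    exact mul_nonneg (Real.rpow_nonneg (by linarith [hx.2]) _) (relaxation_pos hlam hρ hρ1 hx.1).le
  have := mul_nonneg hlam.le h2
  linarith

/-! ### Large times: main term, and remainder on the ray of angle 2π/3 -/

theorem exists_pos_le_sin {a b : ℝ} (ha : 0 < a) (hb : b < Real.pi) :
    ∃ c : ℝ, 0 < c ∧ ∀ y ∈ Icc a b, c ≤ Real.sin y := by
  rcases le_or_gt a b with hab | hab
  · obtain ⟨z, hz, hmin⟩ := isCompact_Icc.exists_isMinOn (nonempty_Icc.2 hab)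
      Real.continuous_sin.continuousOn
    exact ⟨Real.sin z, Real.sin_pos_of_pos_of_lt_pi (ha.trans_le hz.1) (hz.2.trans_lt hb),
      fun y hy => hmin hy⟩
  · exact ⟨1, one_pos, fun y hy => absurd (hy.1.trans hy.2) hab.not_ge⟩

/-- Cauchy's theorem on the rectangles [-n, n] × [y₁, y₂]; the majorant g makes the vertical sides
vanish as n → ∞. -/
theorem integral_line_eq_integral_line {F : ℂ → ℂ} (hF : DifferentiableOn ℂ F closedStrip)
    {y₁ y₂ : ℝ} (h0 : 0 ≤ y₁) (h12 : y₁ ≤ y₂) (h2 : y₂ ≤ Real.pi) {g : ℝ → ℝ}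
    (hg : ∀ x : ℝ, ∀ y ∈ Icc y₁ y₂, ‖F (x + y * Complex.I)‖ ≤ g x) (hint : Integrable g)
    (hbot : Tendsto g atBot (𝓝 0)) (htop : Tendsto g atTop (𝓝 0)) :
    ∫ x : ℝ, F (x + y₁ * Complex.I) = ∫ x : ℝ, F (x + y₂ * Complex.I) := by
  have hc := hF.continuousOn
  have hline : ∀ y ∈ Icc y₁ y₂, Tendsto (fun n : ℝ => ∫ x in (-n)..n, F (x + y * Complex.I)) atTop
      (𝓝 (∫ x : ℝ, F (x + y * Complex.I))) := fun y hy =>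
    intervalIntegral_tendsto_integral
      (hint.mono' (continuous_line_of_strip hc
        ⟨h0.trans hy.1, hy.2.trans h2⟩).aestronglyMeasurable (ae_of_all _ fun x => hg x y hy))
      tendsto_neg_atTop_atBot tendsto_id
  have hseg : ∀ x : ℝ, ‖∫ y in y₁..y₂, F (x + y * Complex.I)‖ ≤ g x * |y₂ - y₁| := fun x =>
    intervalIntegral.norm_integral_le_of_norm_le_const fun y hy => by
      rw [uIoc_of_le h12] at hy
      exact hg x y ⟨hy.1.le, hy.2⟩
  have hseg0 : ∀ u : ℝ → ℝ, Tendsto (fun n => g (u n)) atTop (𝓝 0) →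
      Tendsto (fun n : ℝ => ∫ y in y₁..y₂, F (u n + y * Complex.I)) atTop (𝓝 0) := fun u hu =>
    squeeze_zero_norm (fun n => hseg (u n)) (by simpa using hu.mul_const |y₂ - y₁|)
  have hrect : ∀ n : ℝ, (∫ x in (-n)..n, F (x + y₁ * Complex.I)) -
      (∫ x in (-n)..n, F (x + y₂ * Complex.I)) =
      Complex.I • (∫ y in y₁..y₂, F ((-n : ℝ) + y * Complex.I)) -
        Complex.I • ∫ y in y₁..y₂, F (n + y * Complex.I) := by
    intro n
    have h := Complex.integral_boundary_rect_eq_zero_of_differentiableOn F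
      ((-n : ℝ) + y₁ * Complex.I) (n + y₂ * Complex.I) (hF.mono (by
        intro z hz
        have := hz.2
        simp only [Complex.ofReal_im, Complex.add_im, Complex.mul_im, Complex.I_im, Complex.I_re,
          Complex.ofReal_re, mul_one, mul_zero, add_zero, zero_add, mem_preimage] at this
        rw [uIcc_of_le h12] at this
        exact ⟨h0.trans this.1, this.2.trans h2⟩))
    simp only [Complex.ofReal_im, Complex.add_im, Complex.mul_im, Complex.I_im, Complex.I_re,
      Complex.ofReal_re, mul_one, mul_zero, add_zero, zero_add, Complex.add_re, Complex.mul_re,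
      sub_zero] at h
    linear_combination h
  have hl := (hline y₁ ⟨le_rfl, h12⟩).sub (hline y₂ ⟨h12, le_rfl⟩)
  have hr := ((hseg0 _ (hbot.comp tendsto_neg_atTop_atBot)).const_smul Complex.I).sub
    ((hseg0 _ htop).const_smul Complex.I)
  have := tendsto_nhds_unique (hl.congr hrect) hr
  rw [smul_zero, sub_zero] at this
  exact sub_eq_zero.1 this

/-- The part of `resolventKernel` that remains after expanding `1 / (w + λ)` in powers of `w / λ`
up to first order. -/
noncomputable def remainderKernel (t ρ lam : ℝ) (ζ : ℂ) : ℂ :=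
  Complex.exp (t * Complex.exp ζ) * Complex.exp ζ *
    (Complex.exp (ρ * ζ) ^ 2 / (Complex.exp (ρ * ζ) + lam))

theorem differentiableOn_remainderKernel {t ρ lam : ℝ} (hρ : 0 < ρ) (hρ1 : ρ < 1)
    (hlam : 0 < lam) : DifferentiableOn ℂ (remainderKernel t ρ lam) closedStrip := by
  unfold remainderKernel
  exact DifferentiableOn.mul (by fun_prop) (DifferentiableOn.div (by fun_prop) (by fun_prop)
    fun ζ hζ => exp_mul_add_ne_zero hρ hρ1 hlam hζ)

/-- This is 1/(w + λ) = 1/λ - w/λ² + w²/(λ²(w + λ)). On the line im ζ = π the first term is real and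
the second is explicit. -/
theorem resolventKernel_eq {t ρ lam : ℝ} (hρ : 0 < ρ) (hρ1 : ρ < 1) (hlam : 0 < lam) {ζ : ℂ}
    (hζ : ζ ∈ closedStrip) :
    resolventKernel t ρ lam ζ = ((lam⁻¹ : ℝ) : ℂ) * hankelKernel t 0 ζ +
      (((lam ^ 2)⁻¹ : ℝ) : ℂ) * (remainderKernel t ρ lam ζ - hankelKernel t (-ρ) ζ) := by
  have hne := exp_mul_add_ne_zero hρ hρ1 hlam hζ
  have hlam' : (lam : ℂ) ≠ 0 := by exact_mod_cast hlam.ne'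
  have h1 : Complex.exp (((1 - -ρ : ℝ) : ℂ) * ζ) = Complex.exp ζ * Complex.exp (ρ * ζ) := by
    rw [← Complex.exp_add]; push_cast; ring_nf
  simp only [resolventKernel, remainderKernel, hankelKernel, h1]
  simp only [sub_zero, Complex.ofReal_one, one_mul]
  push_cast
  field_simp
  ring

theorem cos_two_pi_div_three : Real.cos (2 * Real.pi / 3) = -(1 / 2) := by
  rw [show 2 * Real.pi / 3 = Real.pi - Real.pi / 3 by ring, Real.cos_pi_sub,
    Real.cos_pi_div_three]

theorem norm_remainderKernel_prefactor_le {t x y : ℝ} (ht : 0 < t)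
    (hy : y ∈ Icc (2 * Real.pi / 3) Real.pi) :
    ‖Complex.exp (t * Complex.exp (x + y * Complex.I)) * Complex.exp (x + y * Complex.I)‖ ≤
      Real.exp (-(t / 2 * Real.exp x)) * Real.exp x := by
  have hcos : Real.cos y ≤ -(1 / 2) := by
    rw [← cos_two_pi_div_three]
    exact Real.cos_le_cos_of_nonneg_of_le_pi (by positivity) hy.2 hy.1
  have h := norm_hankelKernel t 0 x y
  simp only [hankelKernel, sub_zero, Complex.ofReal_one, one_mul] at h
  rw [h]
  refine mul_le_mul_of_nonneg_right (Real.exp_le_exp.2 ?_) (Real.exp_pos x).le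
  have h1 := mul_le_mul_of_nonneg_left hcos (mul_pos ht (Real.exp_pos x)).le
  linarith

theorem norm_exp_mul_add_mul_I (ρ x y : ℝ) :
    ‖Complex.exp (ρ * (x + y * Complex.I))‖ = Real.exp (ρ * x) := by
  simp [Complex.norm_exp]

theorem norm_remainderKernel_le {t ρ lam x y m : ℝ} (ht : 0 < t)
    (hy : y ∈ Icc (2 * Real.pi / 3) Real.pi) (hm : 0 < m)
    (h : m ≤ ‖Complex.exp (ρ * (x + y * Complex.I)) + lam‖) :
    ‖remainderKernel t ρ lam (x + y * Complex.I)‖ ≤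
      Real.exp (-(t / 2 * Real.exp x)) * Real.exp ((1 + 2 * ρ) * x) * m⁻¹ := by
  rw [remainderKernel, norm_mul, norm_div, norm_pow, norm_exp_mul_add_mul_I]
  calc _ ≤ Real.exp (-(t / 2 * Real.exp x)) * Real.exp x * (Real.exp (ρ * x) ^ 2 / m) := by
        gcongr
        exact norm_remainderKernel_prefactor_le ht hy
    _ = _ := by
        rw [show (1 + 2 * ρ) * x = x + (ρ * x + ρ * x) by ring, Real.exp_add, Real.exp_add]
        ring

theorem two_pi_div_three_mem : 2 * Real.pi / 3 ∈ Icc (2 * Real.pi / 3) Real.pi :=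
  ⟨le_rfl, by linarith [Real.pi_pos]⟩

/-- The constant may degenerate as ρ → 1. It serves only to move the contour and to ensure
integrability at a fixed ρ. -/
theorem exists_norm_remainderKernel_le {t ρ lam : ℝ} (ht : 0 < t) (hρ : 0 < ρ) (hρ1 : ρ < 1)
    (hlam : 0 < lam) :
    ∃ C : ℝ, ∀ x : ℝ, ∀ y ∈ Icc (2 * Real.pi / 3) Real.pi,
      ‖remainderKernel t ρ lam (x + y * Complex.I)‖ ≤
        Real.exp (-(t / 2 * Real.exp x)) * Real.exp ((1 + 2 * ρ) * x) * C := by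
  obtain ⟨c, hc, h⟩ := exists_pos_le_sin (a := ρ * (2 * Real.pi / 3)) (b := ρ * Real.pi)
    (by positivity) (by nlinarith [Real.pi_pos])
  refine ⟨(lam * c)⁻¹, fun x y hy => norm_remainderKernel_le ht hy (by positivity) ?_⟩
  rw [exp_mul_add_mul_I]
  refine le_trans ?_ mul_sin_le_norm_add
  exact mul_le_mul_of_nonneg_left
    (h _ ⟨mul_le_mul_of_nonneg_left hy.1 hρ.le, mul_le_mul_of_nonneg_left hy.2 hρ.le⟩) hlam.le

theorem integral_remainderKernel_line {t ρ lam : ℝ} (ht : 0 < t) (hρ : 0 < ρ) (hρ1 : ρ < 1)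
    (hlam : 0 < lam) :
    Integrable (fun x : ℝ => remainderKernel t ρ lam (x + Real.pi * Complex.I)) ∧
    ∫ x : ℝ, remainderKernel t ρ lam (x + ((2 * Real.pi / 3 : ℝ) : ℂ) * Complex.I) =
      ∫ x : ℝ, remainderKernel t ρ lam (x + Real.pi * Complex.I) := by
  obtain ⟨C, hC⟩ := exists_norm_remainderKernel_le ht hρ hρ1 hlam
  have hF := differentiableOn_remainderKernel (t := t) hρ hρ1 hlam
  have hint := (integrable_exp_neg_mul_exp (half_pos ht)
    (s := 1 + 2 * ρ) (by positivity)).mul_const C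
  refine ⟨hint.mono' (continuous_line_of_strip hF.continuousOn pi_mem_Icc).aestronglyMeasurable
    (ae_of_all _ fun x => hC x _ ⟨two_pi_div_three_mem.2, le_rfl⟩), ?_⟩
  refine integral_line_eq_integral_line hF (by positivity) two_pi_div_three_mem.2 le_rfl hC hint
    ?_ ?_
  · have h1 : Tendsto (fun x : ℝ => Real.exp ((1 + 2 * ρ) * x)) atBot (𝓝 0) :=
      Real.tendsto_exp_atBot.comp (tendsto_id.const_mul_atBot (by positivity))
    have h2 : Tendsto (fun x : ℝ => Real.exp (-(t / 2 * Real.exp x))) atBot (𝓝 1) := by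
      have := (Real.continuous_exp.tendsto _).comp (Real.tendsto_exp_atBot.const_mul (t / 2)).neg
      simpa [Function.comp_def] using this
    simpa using (h2.mul h1).mul_const C
  · simpa using (tendsto_exp_neg_mul_exp_atTop (half_pos ht) (1 + 2 * ρ)).mul_const C

theorem pi_mul_sq_mul_relaxation {t ρ lam : ℝ} (ht : 0 < t) (hρ : 0 < ρ) (hρ1 : ρ < 1)
    (hlam : 0 < lam) :
    Real.pi * lam ^ 2 * relaxation lam ρ ρ t =
      t ^ (-(1 + ρ)) * Real.Gamma (1 + ρ) * Real.sin (ρ * Real.pi) +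
      (∫ x : ℝ, remainderKernel t ρ lam (x + ((2 * Real.pi / 3 : ℝ) : ℂ) * Complex.I)).im := by
  obtain ⟨hint, heq⟩ := integral_remainderKernel_line ht hρ hρ1 hlam
  have hpt : ∀ x : ℝ, (resolventKernel t ρ lam (x + Real.pi * Complex.I)).im =
      (lam ^ 2)⁻¹ * ((remainderKernel t ρ lam (x + Real.pi * Complex.I)).im +
        Real.exp (-(t * Real.exp x)) * Real.exp ((1 + ρ) * x) * Real.sin (ρ * Real.pi)) := by
    intro x
    rw [resolventKernel_eq hρ hρ1 hlam (add_mul_I_mem_closedStrip pi_mem_Icc), Complex.add_im,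
      Complex.im_ofReal_mul, Complex.im_ofReal_mul, Complex.sub_im, hankelKernel_line_im,
      hankelKernel_line_im, sub_zero, one_mul, one_mul, Real.sin_pi, sub_neg_eq_add,
      show (1 + ρ) * Real.pi = ρ * Real.pi + Real.pi by ring, Real.sin_add_pi]
    ring
  have h1ρ : 0 < 1 + ρ := by positivity
  have him : ∫ x : ℝ, (remainderKernel t ρ lam (x + Real.pi * Complex.I)).im =
      (∫ x : ℝ, remainderKernel t ρ lam (x + Real.pi * Complex.I)).im :=
    Complex.imCLM.integral_comp_comm hint
  have himint : Integrable fun x : ℝ => (remainderKernel t ρ lam (x + Real.pi * Complex.I)).im :=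
    Complex.imCLM.integrable_comp hint
  rw [mul_right_comm, pi_mul_relaxation_eq_integral ht hρ hρ1 hlam, heq]
  simp_rw [hpt]
  rw [integral_const_mul, integral_add himint
    ((integrable_exp_neg_mul_exp ht h1ρ).mul_const _), integral_mul_const,
    integral_exp_neg_mul_exp ht h1ρ, him]
  field_simp
  ring

/-- The derivative of `remainderKernel` with respect to the order `ρ`. -/
noncomputable def remainderKernelDeriv (t ρ lam : ℝ) (ζ : ℂ) : ℂ :=
  Complex.exp (t * Complex.exp ζ) * Complex.exp ζ *
    (ζ * Complex.exp (ρ * ζ) ^ 2 * (Complex.exp (ρ * ζ) + 2 * lam) /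
      (Complex.exp (ρ * ζ) + lam) ^ 2)

theorem hasDerivAt_remainderKernel {t ρ lam : ℝ} {ζ : ℂ}
    (h : Complex.exp (ρ * ζ) + lam ≠ 0) :
    HasDerivAt (fun ρ : ℝ => remainderKernel t ρ lam ζ) (remainderKernelDeriv t ρ lam ζ) ρ := by
  have hw : HasDerivAt (fun ρ : ℝ => Complex.exp (ρ * ζ)) (Complex.exp (ρ * ζ) * ζ) ρ := by
    have h1 : HasDerivAt (fun z : ℂ => Complex.exp (z * ζ)) (Complex.exp (ρ * ζ) * (1 * ζ)) (ρ : ℂ) :=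
      ((hasDerivAt_id (ρ : ℂ)).mul_const ζ).cexp
    rw [one_mul] at h1
    exact h1.comp_ofReal
  refine (((hw.pow 2).div (hw.add_const (lam : ℂ)) h).const_mul
    (Complex.exp (t * Complex.exp ζ) * Complex.exp ζ)).congr_deriv ?_
  rw [remainderKernelDeriv]
  congr 2
  simp only [Pi.pow_apply]
  push_cast
  ring

/-- The gain from the angle 2π/3: the argument of w stays below 2π/3, so cos ≥ -1/2 and |w + λ|² ≥
r² - rλ + λ², uniformly in ρ. -/
theorem half_le_norm_add {ρ lam x : ℝ} (hρ : 0 < ρ) (hρ1 : ρ < 1) (hlam : 0 < lam) :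
    lam / 2 ≤ ‖Complex.exp (ρ * (x + ((2 * Real.pi / 3 : ℝ) : ℂ) * Complex.I)) + lam‖ := by
  rw [exp_mul_add_mul_I]
  set φ := ρ * (2 * Real.pi / 3)
  set r := Real.exp (ρ * x)
  have hr : 0 < r := Real.exp_pos _
  have hcos : -(1 / 2) ≤ Real.cos φ := by
    rw [← cos_two_pi_div_three]
    exact Real.cos_le_cos_of_nonneg_of_le_pi (by positivity) (by linarith [Real.pi_pos])
      (by simp only [φ]; nlinarith [Real.pi_pos])
  have h2 : (lam / 2) ^ 2 ≤ ‖(r : ℂ) * Complex.exp ((φ : ℂ) * Complex.I) + lam‖ ^ 2 := by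
    rw [← Complex.normSq_eq_norm_sq, Complex.normSq_apply]
    simp only [Complex.add_re, Complex.add_im, Complex.re_ofReal_mul, Complex.im_ofReal_mul,
      Complex.exp_ofReal_mul_I_re, Complex.exp_ofReal_mul_I_im, Complex.ofReal_re, Complex.ofReal_im]
    have e : (r * Real.cos φ + lam) * (r * Real.cos φ + lam) +
        (r * Real.sin φ + 0) * (r * Real.sin φ + 0) =
        r ^ 2 + 2 * (r * lam) * Real.cos φ + lam ^ 2 := by
      linear_combination r ^ 2 * Real.sin_sq_add_cos_sq φ
    rw [e]
    have := mul_le_mul_of_nonneg_left hcos (mul_pos hr hlam).le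
    nlinarith [sq_nonneg (r - lam / 2)]
  exact abs_le_of_sq_le_sq' h2 (norm_nonneg _) |>.2

theorem norm_remainderKernelDeriv_le {t ρ lam x : ℝ} (ht : 0 < t) (hρ : 0 < ρ) (hρ1 : ρ < 1)
    (hlam : 0 < lam) :
    ‖remainderKernelDeriv t ρ lam (x + ((2 * Real.pi / 3 : ℝ) : ℂ) * Complex.I)‖ ≤
      6 / lam * (Real.exp (-(t / 2 * Real.exp x)) * Real.exp ((1 + 2 * ρ) * x) *
        (|x| + Real.pi)) := by
  have hm := half_le_norm_add (x := x) hρ hρ1 hlam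
  set ζ : ℂ := x + ((2 * Real.pi / 3 : ℝ) : ℂ) * Complex.I
  have hpre : ‖Complex.exp (t * Complex.exp ζ) * Complex.exp ζ‖ ≤ _ :=
    norm_remainderKernel_prefactor_le (x := x) ht two_pi_div_three_mem
  have hw : ‖Complex.exp (ρ * ζ)‖ = Real.exp (ρ * x) := norm_exp_mul_add_mul_I _ _ _
  have hζ : ‖ζ‖ ≤ |x| + Real.pi := by
    refine (norm_add_le _ _).trans ?_
    rw [norm_mul, Complex.norm_I, Complex.norm_real, Complex.norm_real, mul_one,
      Real.norm_of_nonneg (by positivity : (0 : ℝ) ≤ 2 * Real.pi / 3), Real.norm_eq_abs]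
    linarith [Real.pi_pos]
  set w := Complex.exp (ρ * ζ) with hwdef
  have hpos : 0 < ‖w + lam‖ := (half_pos hlam).trans_le hm
  -- With m = |w + λ| ≥ λ/2 the quotient is at most 1/m + λ/m² ≤ 2/λ + 4/λ.
  have hq : ‖w + 2 * lam‖ / ‖w + lam‖ ^ 2 ≤ 6 / lam := by
    have h1 : ‖w + 2 * lam‖ ≤ ‖w + lam‖ + lam := by
      rw [two_mul, ← add_assoc]
      refine (norm_add_le _ _).trans ?_
      rw [Complex.norm_real, Real.norm_of_nonneg hlam.le]
    rw [div_le_div_iff₀ (by positivity) hlam]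
    nlinarith [mul_le_mul_of_nonneg_right h1 hlam.le, mul_le_mul_of_nonneg_left hm hpos.le]
  rw [remainderKernelDeriv, ← hwdef, norm_mul, norm_div, norm_mul (ζ * w ^ 2), norm_mul ζ, norm_pow,
    norm_pow, hw]
  calc _ ≤ Real.exp (-(t / 2 * Real.exp x)) * Real.exp x *
        ((|x| + Real.pi) * Real.exp (ρ * x) ^ 2 * (6 / lam)) := by
        rw [mul_div_assoc]
        gcongr
    _ = _ := by
        rw [show (1 + 2 * ρ) * x = x + (ρ * x + ρ * x) by ring, Real.exp_add, Real.exp_add]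
        ring

theorem abs_le_two_mul_exp_add (x : ℝ) : |x| ≤ 2 * (Real.exp (x / 2) + Real.exp (-(x / 2))) := by
  have h1 := Real.add_one_le_exp (x / 2)
  have h2 := Real.add_one_le_exp (-(x / 2))
  have h3 := Real.exp_pos (x / 2)
  have h4 := Real.exp_pos (-(x / 2))
  rw [abs_le]
  constructor <;> linarith

/-- The factor |x|, which comes from differentiating e^(ρζ) in ρ, is absorbed by e^(x/2) + e^(-x/2).
This shifts s by 1/2 either way, hence s > 1/2. -/
theorem integrable_exp_neg_mul_exp_mul_abs {t s : ℝ} (ht : 0 < t) (hs : 1 / 2 < s) :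
    Integrable fun x : ℝ =>
      Real.exp (-(t * Real.exp x)) * Real.exp (s * x) * (|x| + Real.pi) := by
  have h1 := (integrable_exp_neg_mul_exp ht (s := s + 1 / 2) (by linarith)).const_mul 2
  have h2 := (integrable_exp_neg_mul_exp ht (s := s - 1 / 2) (by linarith)).const_mul 2
  have h3 := (integrable_exp_neg_mul_exp ht (s := s) (by linarith)).mul_const Real.pi
  refine ((h1.add h2).add h3).mono' (Continuous.aestronglyMeasurable (by fun_prop))
    (ae_of_all _ fun x => ?_)
  have hpi := Real.pi_pos
  rw [Real.norm_of_nonneg (by positivity)]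
  simp only [Pi.add_apply]
  rw [show (s + 1 / 2) * x = s * x + x / 2 by ring, show (s - 1 / 2) * x = s * x + -(x / 2) by ring,
    Real.exp_add, Real.exp_add]
  have := mul_le_mul_of_nonneg_left (abs_le_two_mul_exp_add x)
    (show 0 ≤ Real.exp (-(t * Real.exp x)) * Real.exp (s * x) by positivity)
  linarith

theorem exp_mul_le_exp_add_exp {ρ x : ℝ} (hρ : 0 < ρ) (hρ1 : ρ < 1) :
    Real.exp ((1 + 2 * ρ) * x) ≤ Real.exp (1 * x) + Real.exp (3 * x) := by
  rcases le_total 0 x with h | h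
  · have := Real.exp_le_exp.2 (show (1 + 2 * ρ) * x ≤ 3 * x by nlinarith)
    linarith [Real.exp_pos (1 * x)]
  · have := Real.exp_le_exp.2 (show (1 + 2 * ρ) * x ≤ 1 * x by nlinarith)
    linarith [Real.exp_pos (3 * x)]

/-- The integral of the dominating function for `remainderKernelDeriv` at time `1`. -/
noncomputable def dominatingIntegral : ℝ :=
  ∫ x : ℝ, Real.exp (-(1 / 2 * Real.exp x)) * Real.exp (1 * x) * (|x| + Real.pi) +
    Real.exp (-(1 / 2 * Real.exp x)) * Real.exp (3 * x) * (|x| + Real.pi)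

theorem integral_exp_mul_abs_le {t ρ : ℝ} (ht : 1 ≤ t) (hρ : 0 < ρ) (hρ1 : ρ < 1) :
    ∫ x : ℝ, Real.exp (-(t / 2 * Real.exp x)) * Real.exp ((1 + 2 * ρ) * x) * (|x| + Real.pi) ≤
      t ^ (-(1 + 2 * ρ)) * ((1 + Real.log t) * dominatingIntegral) := by
  have ht0 : 0 < t := by linarith
  have hlog := Real.log_nonneg ht
  -- The translation x ↦ x - log t scales t out: it produces the power of t, and |x - log t| costs
  -- the factor 1 + log t.
  rw [← integral_add_right_eq_self _ (-Real.log t), dominatingIntegral, ← integral_const_mul,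
    ← integral_const_mul]
  have hi1 := integrable_exp_neg_mul_exp_mul_abs (t := 1 / 2) (s := 1) (by norm_num) (by norm_num)
  have hi3 := integrable_exp_neg_mul_exp_mul_abs (t := 1 / 2) (s := 3) (by norm_num) (by norm_num)
  refine integral_mono_of_nonneg (ae_of_all _ fun x => ?_)
    (((hi1.add hi3).const_mul _).const_mul _) (ae_of_all _ fun x => ?_)
  · have := Real.pi_pos
    simp only [Pi.zero_apply]; positivity
  · have h1 : t / 2 * Real.exp (x + -Real.log t) = 1 / 2 * Real.exp x := by
      rw [Real.exp_add, Real.exp_neg, Real.exp_log ht0]; field_simp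
    have h2 : Real.exp ((1 + 2 * ρ) * (x + -Real.log t)) =
        t ^ (-(1 + 2 * ρ)) * Real.exp ((1 + 2 * ρ) * x) := by
      rw [Real.rpow_def_of_pos ht0, ← Real.exp_add]; congr 1; ring
    have h3 : |x + -Real.log t| + Real.pi ≤ (1 + Real.log t) * (|x| + Real.pi) := by
      have := abs_add_le x (-Real.log t)
      rw [abs_neg, abs_of_nonneg hlog] at this
      nlinarith [Real.pi_gt_three, abs_nonneg x, mul_nonneg hlog (abs_nonneg x)]
    beta_reduce
    rw [h1, h2]
    calc Real.exp (-(1 / 2 * Real.exp x)) * (t ^ (-(1 + 2 * ρ)) * Real.exp ((1 + 2 * ρ) * x)) *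
          (|x + -Real.log t| + Real.pi)
        ≤ Real.exp (-(1 / 2 * Real.exp x)) * (t ^ (-(1 + 2 * ρ)) *
          (Real.exp (1 * x) + Real.exp (3 * x))) * ((1 + Real.log t) * (|x| + Real.pi)) := by
          gcongr
          exact exp_mul_le_exp_add_exp hρ hρ1
      _ = _ := by ring

/-- Differentiation under the integral; replacing e^((1+2ρ)x) by e^x + e^(3x) gives one majorant for
all orders in (0, 1). -/
theorem hasDerivAt_integral_remainderKernel {t ρ lam : ℝ} (ht : 0 < t) (hρ : 0 < ρ) (hρ1 : ρ < 1)
    (hlam : 0 < lam) :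
    HasDerivAt (fun ρ : ℝ => ∫ x : ℝ,
        remainderKernel t ρ lam (x + ((2 * Real.pi / 3 : ℝ) : ℂ) * Complex.I))
      (∫ x : ℝ, remainderKernelDeriv t ρ lam (x + ((2 * Real.pi / 3 : ℝ) : ℂ) * Complex.I)) ρ := by
  have hθ : 2 * Real.pi / 3 ∈ Icc 0 Real.pi := ⟨by positivity, two_pi_div_three_mem.2⟩
  have hcont : ∀ ρ : ℝ, 0 < ρ → ρ < 1 → Continuous fun x : ℝ =>
      remainderKernel t ρ lam (x + ((2 * Real.pi / 3 : ℝ) : ℂ) * Complex.I) := fun ρ h h' =>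
    continuous_line_of_strip (differentiableOn_remainderKernel h h' hlam).continuousOn hθ
  have hne : ∀ ρ : ℝ, 0 < ρ → ρ < 1 → ∀ x : ℝ,
      Complex.exp (ρ * (x + ((2 * Real.pi / 3 : ℝ) : ℂ) * Complex.I)) + lam ≠ 0 := fun ρ h h' x =>
    exp_mul_add_ne_zero h h' hlam (add_mul_I_mem_closedStrip hθ)
  have hmem : Ioo (0 : ℝ) 1 ∈ 𝓝 ρ := Ioo_mem_nhds hρ hρ1
  have hi1 := integrable_exp_neg_mul_exp_mul_abs (half_pos ht) (s := 1) (by norm_num)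
  have hi3 := integrable_exp_neg_mul_exp_mul_abs (half_pos ht) (s := 3) (by norm_num)
  refine (hasDerivAt_integral_of_dominated_loc_of_deriv_le (𝕜 := ℝ) (E := ℂ) (s := Ioo 0 1)
    (F := fun (ρ x : ℝ) => remainderKernel t ρ lam (x + ((2 * Real.pi / 3 : ℝ) : ℂ) * Complex.I))
    (F' := fun (ρ x : ℝ) =>
      remainderKernelDeriv t ρ lam (x + ((2 * Real.pi / 3 : ℝ) : ℂ) * Complex.I))
    (bound := fun x => 6 / lam *
      (Real.exp (-(t / 2 * Real.exp x)) * Real.exp (1 * x) * (|x| + Real.pi) +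
        Real.exp (-(t / 2 * Real.exp x)) * Real.exp (3 * x) * (|x| + Real.pi)))
    hmem ?_ ?_ ?_ ?_ ?_ ?_).2
  · filter_upwards [hmem] with σ hσ using (hcont σ hσ.1 hσ.2).aestronglyMeasurable
  · obtain ⟨C, hC⟩ := exists_norm_remainderKernel_le ht hρ hρ1 hlam
    exact ((integrable_exp_neg_mul_exp (half_pos ht) (s := 1 + 2 * ρ) (by positivity)).mul_const
      C).mono' (hcont ρ hρ hρ1).aestronglyMeasurable
      (ae_of_all _ fun x => hC x _ two_pi_div_three_mem)
  · refine Continuous.aestronglyMeasurable ?_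
    unfold remainderKernelDeriv
    refine Continuous.mul (by fun_prop) (Continuous.div (by fun_prop) (by fun_prop) fun x => ?_)
    exact pow_ne_zero 2 (hne ρ hρ hρ1 x)
  · refine ae_of_all _ fun x σ hσ => (norm_remainderKernelDeriv_le ht hσ.1 hσ.2 hlam).trans ?_
    refine mul_le_mul_of_nonneg_left ?_ (by positivity)
    have := mul_le_mul_of_nonneg_left (exp_mul_le_exp_add_exp (x := x) hσ.1 hσ.2)
      (show 0 ≤ Real.exp (-(t / 2 * Real.exp x)) * (|x| + Real.pi) by
        have := Real.pi_pos
        positivity)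
    linarith
  · exact (hi1.add hi3).const_mul _
  · exact ae_of_all _ fun x σ hσ => hasDerivAt_remainderKernel (hne σ hσ.1 hσ.2 x)

theorem norm_integral_remainderKernelDeriv_le {t ρ lam : ℝ} (ht : 1 ≤ t) (hρ : 0 < ρ) (hρ1 : ρ < 1)
    (hlam : 0 < lam) :
    ‖∫ x : ℝ, remainderKernelDeriv t ρ lam (x + ((2 * Real.pi / 3 : ℝ) : ℂ) * Complex.I)‖ ≤
      6 / lam * (t ^ (-(1 + 2 * ρ)) * ((1 + Real.log t) * dominatingIntegral)) := by
  have ht0 : 0 < t := by linarith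
  have hi := (integrable_exp_neg_mul_exp_mul_abs (half_pos ht0) (s := 1 + 2 * ρ)
    (by linarith)).const_mul (6 / lam)
  refine (norm_integral_le_of_norm_le hi (ae_of_all _ fun x =>
    norm_remainderKernelDeriv_le ht0 hρ hρ1 hlam)).trans ?_
  rw [integral_const_mul]
  exact mul_le_mul_of_nonneg_left (integral_exp_mul_abs_le ht hρ hρ1) (by positivity)

theorem dominatingIntegral_nonneg : 0 ≤ dominatingIntegral := by
  have := Real.pi_pos
  exact integral_nonneg fun x => by simp only [Pi.zero_apply]; positivity

/-! ### Sign of the derivative in the order -/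

theorem Gamma_one_add_le_one {ρ : ℝ} (hρ : 0 ≤ ρ) (hρ1 : ρ ≤ 1) : Real.Gamma (1 + ρ) ≤ 1 := by
  have h := Real.convexOn_Gamma.2 (show (1 : ℝ) ∈ Ioi 0 by simp) (show (2 : ℝ) ∈ Ioi 0 by simp)
    (sub_nonneg.2 hρ1) hρ (by ring)
  simp only [smul_eq_mul, Real.Gamma_one, Real.Gamma_two] at h
  rw [show (1 - ρ) * 1 + ρ * 2 = 1 + ρ by ring] at h
  linarith

theorem Gamma_three : Real.Gamma 3 = 2 := by
  norm_num [Nat.factorial]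

/-- By convexity the slope of Gamma from 1 + ρ to 2 is at most its slope from 2 to 3, which is 1. -/
theorem le_Gamma_one_add {ρ : ℝ} (hρ : 0 ≤ ρ) (hρ1 : ρ < 1) : ρ ≤ Real.Gamma (1 + ρ) := by
  have h := Real.convexOn_Gamma.slope_mono_adjacent (x := 1 + ρ) (y := 2) (z := 3)
    (by simp only [mem_Ioi]; positivity) (by simp) (by linarith) (by norm_num)
  rw [Gamma_three, Real.Gamma_two, div_le_iff₀ (by linarith)] at h
  linarith

theorem deriv_Gamma_one_add_le {ρ : ℝ} (hρ : 0 ≤ ρ) (hρ1 : ρ < 1) :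
    deriv Real.Gamma (1 + ρ) ≤ 2 := by
  have hd : DifferentiableAt ℝ Real.Gamma (1 + ρ) := Real.differentiableAt_Gamma fun m hm => by
    have : (0 : ℝ) ≤ m := Nat.cast_nonneg m
    linarith
  have h := Real.convexOn_Gamma.deriv_le_slope (x := 1 + ρ) (y := 3)
    (by simp only [mem_Ioi]; positivity) (by simp) (by linarith) hd
  refine h.trans ?_
  rw [slope_def_field, Gamma_three, div_le_iff₀ (by linarith)]
  have := Real.Gamma_pos_of_pos (show 0 < 1 + ρ by positivity)
  linarith

/-- With L = log t, the left side is the ρ-derivative of t^(-1-ρ) Γ(1+ρ) sin(ρπ) divided by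
t^(-1-ρ). Up to ρ = 3/4 the sine is bounded below and the term with L dominates. Beyond 3/4 the sine
may be small, but the cosine is at most -1/2. -/
theorem exists_main_term_le {ρ₀ : ℝ} (hρ₀ : 0 < ρ₀) :
    ∃ L₀ : ℝ, ∀ L : ℝ, L₀ ≤ L → ∀ ρ : ℝ, ρ₀ ≤ ρ → ρ < 1 →
      deriv Real.Gamma (1 + ρ) * Real.sin (ρ * Real.pi) +
        Real.Gamma (1 + ρ) * (Real.cos (ρ * Real.pi) * Real.pi) -
        L * (Real.Gamma (1 + ρ) * Real.sin (ρ * Real.pi)) ≤ -1 := by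
  have hpi := Real.pi_pos
  obtain ⟨c, hc, h⟩ := exists_pos_le_sin (a := ρ₀ * Real.pi) (b := 3 / 4 * Real.pi)
    (by positivity) (by linarith)
  -- As Γ(1+ρ) ≥ ρ ≥ ρ₀ and Γ'(1+ρ) ≤ 2, the first bound makes Γ' - LΓ ≤ -(π+1)/c. The bound 3 gives
  -- Γ' - LΓ ≤ 2 - 3·(3/4) < 0 when ρ > 3/4.
  refine ⟨max ((2 + (Real.pi + 1) / c) / ρ₀) 3, fun L hL ρ hρ hρ1 => ?_⟩
  have hL1 := (le_max_left _ _).trans hL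
  have hL3 := (le_max_right _ _).trans hL
  have hρ0 : 0 < ρ := hρ₀.trans_le hρ
  have hG1 := Gamma_one_add_le_one hρ0.le hρ1.le
  have hGρ := le_Gamma_one_add hρ0.le hρ1
  have hD := deriv_Gamma_one_add_le hρ0.le hρ1
  set G := Real.Gamma (1 + ρ)
  set D := deriv Real.Gamma (1 + ρ)
  have hs : 0 < Real.sin (ρ * Real.pi) :=
    Real.sin_pos_of_pos_of_lt_pi (by positivity) (by nlinarith)
  have hG0 : 0 < G := hρ0.trans_le hGρ
  rcases le_or_gt ρ (3 / 4) with h34 | h34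
  · have hsc := h (ρ * Real.pi) ⟨by nlinarith, by nlinarith⟩
    rw [div_le_iff₀ hρ₀] at hL1
    have h1 : L * ρ₀ ≤ L * G := mul_le_mul_of_nonneg_left (hρ.trans hGρ) (by linarith)
    have h2 : D - L * G ≤ -((Real.pi + 1) / c) := by linarith
    have h3 : (D - L * G) * Real.sin (ρ * Real.pi) ≤ -(Real.pi + 1) := by
      have h5 : (Real.pi + 1) / c * c ≤ (Real.pi + 1) / c * Real.sin (ρ * Real.pi) :=
        mul_le_mul_of_nonneg_left hsc (by positivity)
      rw [div_mul_cancel₀ _ hc.ne'] at h5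
      have h6 := mul_le_mul_of_nonneg_right h2 hs.le
      linarith
    have h4 : G * (Real.cos (ρ * Real.pi) * Real.pi) ≤ Real.pi := by
      have : Real.cos (ρ * Real.pi) * Real.pi ≤ Real.pi :=
        mul_le_of_le_one_left hpi.le (Real.cos_le_one _)
      calc G * (Real.cos (ρ * Real.pi) * Real.pi) ≤ G * Real.pi :=
            mul_le_mul_of_nonneg_left this hG0.le
        _ ≤ Real.pi := mul_le_of_le_one_left hpi.le hG1
    linarith
  · have hcos : Real.cos (ρ * Real.pi) ≤ -(1 / 2) := by
      rw [← cos_two_pi_div_three]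
      exact Real.cos_le_cos_of_nonneg_of_le_pi (by positivity) (by nlinarith) (by nlinarith)
    have h3 : (D - L * G) * Real.sin (ρ * Real.pi) ≤ 0 :=
      mul_nonpos_of_nonpos_of_nonneg (by nlinarith) hs.le
    have h4 : G * (Real.cos (ρ * Real.pi) * Real.pi) ≤ -1 := by
      -- Since Γ(1+ρ) ≥ ρ > 3/4 and π > 3, the product is below -(3/4)(3/2) = -9/8.
      have h5 : Real.cos (ρ * Real.pi) * Real.pi ≤ -(3 / 2) := by
        nlinarith [Real.pi_gt_three]
      nlinarith
    linarith

theorem exists_strictAntiOn_relaxation {ρ₀ lam₁ : ℝ} (hρ₀ : 0 < ρ₀) (hlam₁ : 0 < lam₁) :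
    ∃ T₀ : ℝ, 0 < T₀ ∧ ∀ t : ℝ, T₀ ≤ t → ∀ lam : ℝ, lam₁ ≤ lam →
      StrictAntiOn (fun ρ : ℝ => relaxation lam ρ ρ t) (Icc ρ₀ 1) := by
  obtain ⟨L₀, hL₀⟩ := exists_main_term_le hρ₀
  have hlim : Tendsto (fun t : ℝ => 6 / lam₁ * dominatingIntegral *
      (t ^ (-ρ₀) + Real.log t / t ^ ρ₀)) atTop (𝓝 0) := by
    have h1 := tendsto_rpow_neg_atTop hρ₀
    have h2 := (isLittleO_log_rpow_atTop hρ₀).tendsto_div_nhds_zero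
    simpa using (h1.add h2).const_mul (6 / lam₁ * dominatingIntegral)
  have hev := (hlim.eventually_lt_const one_pos).and
    ((Real.tendsto_log_atTop.eventually_ge_atTop L₀).and (eventually_ge_atTop (1 : ℝ)))
  obtain ⟨T, hT⟩ := eventually_atTop.1 hev
  refine ⟨max T 1, by positivity, fun t ht lam hlam => ?_⟩
  obtain ⟨hsmall, hlogL, ht1⟩ := hT t ((le_max_left _ _).trans ht)
  have ht0 : 0 < t := by linarith
  have hlam0 : 0 < lam := hlam₁.trans_le hlam
  have hlog := Real.log_nonneg ht1
  -- The derivative is needed only for ρ₀ < ρ < 1; continuity takes care of the endpoints.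
  refine strictAntiOn_of_deriv_neg (convex_Icc _ _) (continuousOn_relaxation_order hρ₀ ht0) ?_
  intro ρ hρ
  rw [interior_Icc] at hρ
  have hρ0 : 0 < ρ := hρ₀.trans hρ.1
  have hρ1 := hρ.2
  have hpi := Real.pi_pos
  have hR := hasDerivAt_integral_remainderKernel ht0 hρ0 hρ1 hlam0
  have hRle := norm_integral_remainderKernelDeriv_le ht1 hρ0 hρ1 hlam0
  set R' := ∫ x : ℝ, remainderKernelDeriv t ρ lam (x + ((2 * Real.pi / 3 : ℝ) : ℂ) * Complex.I)
  have hRim := Complex.imCLM.hasFDerivAt.comp_hasDerivAt ρ hR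
  have hpow : HasDerivAt (fun ρ : ℝ => t ^ (-(1 + ρ))) (-(t ^ (-(1 + ρ)) * Real.log t)) ρ := by
    have h1 : HasDerivAt (fun ρ : ℝ => -(1 + ρ)) (-1) ρ := ((hasDerivAt_id ρ).const_add 1).neg
    have := h1.const_rpow ht0
    refine this.congr_deriv ?_
    ring
  have hGam : HasDerivAt (fun ρ : ℝ => Real.Gamma (1 + ρ)) (deriv Real.Gamma (1 + ρ)) ρ := by
    have hd : DifferentiableAt ℝ Real.Gamma (1 + ρ) := Real.differentiableAt_Gamma fun m hm => by
      have : (0 : ℝ) ≤ m := Nat.cast_nonneg m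
      linarith
    exact hd.hasDerivAt.comp_const_add 1 ρ
  have hsin : HasDerivAt (fun ρ : ℝ => Real.sin (ρ * Real.pi))
      (Real.cos (ρ * Real.pi) * Real.pi) ρ := by
    simpa using ((hasDerivAt_id ρ).mul_const Real.pi).sin
  have htot := (((hpow.mul hGam).mul hsin).add hRim).const_mul (Real.pi * lam ^ 2)⁻¹
  have hder := htot.congr_of_eventuallyEq (f₁ := fun ρ : ℝ => relaxation lam ρ ρ t) (by
    filter_upwards [Ioo_mem_nhds hρ0 hρ1] with σ hσ
    have h := pi_mul_sq_mul_relaxation ht0 hσ.1 hσ.2 hlam0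
    show relaxation lam σ σ t = (Real.pi * lam ^ 2)⁻¹ *
      (t ^ (-(1 + σ)) * Real.Gamma (1 + σ) * Real.sin (σ * Real.pi) +
      (∫ x : ℝ, remainderKernel t σ lam (x + ((2 * Real.pi / 3 : ℝ) : ℂ) * Complex.I)).im)
    rw [← h]
    field_simp)
  rw [hder.deriv]
  refine mul_neg_of_pos_of_neg (by positivity) ?_
  have hmain := hL₀ (Real.log t) hlogL ρ hρ.1.le hρ1
  have hP : 0 < t ^ (-(1 + ρ)) := Real.rpow_pos_of_pos ht0 _
  -- Relative to the main term the remainder carries the extra factor t^(-ρ)(1 + log t)/λ, which is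
  -- largest at ρ₀ and λ₁. The choice of T makes it small for all λ and ρ at once.
  have hrem : R'.im < t ^ (-(1 + ρ)) := by
    refine ((le_abs_self _).trans (Complex.abs_im_le_norm _)).trans_lt (hRle.trans_lt ?_)
    have hK := dominatingIntegral_nonneg
    calc 6 / lam * (t ^ (-(1 + 2 * ρ)) * ((1 + Real.log t) * dominatingIntegral))
        = t ^ (-(1 + ρ)) * (6 / lam * dominatingIntegral * (t ^ (-ρ) * (1 + Real.log t))) := by
          rw [show -(1 + 2 * ρ) = -(1 + ρ) + -ρ by ring, Real.rpow_add ht0]; ring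
      _ ≤ t ^ (-(1 + ρ)) * (6 / lam₁ * dominatingIntegral * (t ^ (-ρ₀) * (1 + Real.log t))) := by
          gcongr
          exact hρ.1.le
      _ = t ^ (-(1 + ρ)) * (6 / lam₁ * dominatingIntegral * (t ^ (-ρ₀) + Real.log t / t ^ ρ₀)) := by
          rw [Real.rpow_neg ht0.le ρ₀]; ring
      _ < t ^ (-(1 + ρ)) * 1 := mul_lt_mul_of_pos_left hsmall hP
      _ = _ := mul_one _
  have hmul := mul_le_mul_of_nonneg_left hmain hP.le
  have him : Complex.imCLM R' = R'.im := rfl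
  rw [him]
  simp only [Pi.mul_apply]
  nlinarith

/-! ### Uniqueness for the scalar fractional equation -/

theorem eq_zero_of_hasDerivWithinAt_zero {E : Type*} [NormedAddCommGroup E] [NormedSpace ℝ E]
    {T : ℝ} {G : ℝ → E} (hG : ∀ t ∈ Ioc 0 T, HasDerivWithinAt G 0 (Ioc 0 T) t)
    (hlim : Tendsto G (𝓝[>] 0) (𝓝 0)) {t : ℝ} (ht : t ∈ Ioc 0 T) : G t = 0 := by
  have hconst : ∀ s ∈ Ioc 0 T, G s = G t := fun s hs => by
    have := (convex_Ioc 0 T).norm_image_sub_le_of_norm_hasDerivWithin_le (C := 0) hG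
      (fun x _ => by simp) ht hs
    rw [zero_mul, norm_le_zero_iff] at this
    exact sub_eq_zero.1 this
  have hmem : Ioc 0 T ∈ 𝓝[>] (0 : ℝ) := Ioc_mem_nhdsGT (ht.1.trans_le ht.2)
  have h2 : Tendsto G (𝓝[>] 0) (𝓝 (G t)) :=
    tendsto_const_nhds.congr' (by filter_upwards [hmem] with s hs using (hconst s hs).symm)
  exact tendsto_nhds_unique h2 hlim

theorem hasDerivWithinAt_integral_Ioc {E : Type*} [NormedAddCommGroup E] [NormedSpace ℝ E]
    [CompleteSpace E] {T : ℝ} {y : ℝ → E} (hy : IntervalIntegrable y volume 0 T)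
    (hc : ContinuousOn y (Ioc 0 T)) {t : ℝ} (ht : t ∈ Ioc 0 T) :
    HasDerivWithinAt (fun s => ∫ ξ in (0 : ℝ)..s, y ξ) (y t) (Ioc 0 T) t := by
  have hsub : Icc (t / 2) T ⊆ Ioc 0 T := fun x hx => ⟨by linarith [hx.1, ht.1], hx.2⟩
  have hmem : t ∈ Icc (t / 2) T := ⟨by linarith [ht.1], ht.2⟩
  have : Fact (t ∈ Icc (t / 2) T) := ⟨hmem⟩
  have hc' : ContinuousOn y (Icc (t / 2) T) := hc.mono hsub
  have h := intervalIntegral.integral_hasDerivWithinAt_right (s := Icc (t / 2) T)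
    (t := Icc (t / 2) T)
    (hy.mono_set (by
      rw [uIcc_of_le ht.1.le, uIcc_of_le (ht.1.trans_le ht.2).le]
      exact Icc_subset_Icc le_rfl ht.2))
    (hc'.stronglyMeasurableAtFilter_nhdsWithin measurableSet_Icc t) (hc' t hmem)
  refine h.mono_of_mem_nhdsWithin ?_
  have : Ioi (t / 2) ∈ 𝓝 t := Ioi_mem_nhds (by linarith [ht.1])
  filter_upwards [mem_nhdsWithin_of_mem_nhds this, self_mem_nhdsWithin] with x hx hx'
  exact ⟨le_of_lt hx, hx'.2⟩

theorem integral_rpow_mul_exp_neg_le {ρ M t : ℝ} (hρ : 0 < ρ) (hM : 0 < M) (ht : 0 ≤ t) :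
    IntervalIntegrable (fun s : ℝ => (t - s) ^ (ρ - 1) * Real.exp (-(M * (t - s)))) volume 0 t ∧
    ∫ s in (0 : ℝ)..t, (t - s) ^ (ρ - 1) * Real.exp (-(M * (t - s))) ≤
      (1 / M) ^ ρ * Real.Gamma ρ := by
  have hint : IntegrableOn (fun u : ℝ => u ^ (ρ - 1) * Real.exp (-(M * u))) (Ioi 0) := by
    simpa using integrableOn_rpow_mul_exp_neg_mul_rpow (s := ρ - 1) (p := 1) (b := M)
      (by linarith) one_pos hM
  constructor
  · have h : IntervalIntegrable (fun u : ℝ => u ^ (ρ - 1) * Real.exp (-(M * u))) volume 0 t :=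
      (intervalIntegrable_iff_integrableOn_Ioc_of_le ht).2 (hint.mono_set fun x hx => hx.1)
    simpa using (h.comp_sub_left t).symm
  · have h := intervalIntegral.integral_comp_sub_left (a := 0) (b := t)
      (fun u : ℝ => u ^ (ρ - 1) * Real.exp (-(M * u))) t
    rw [sub_self, sub_zero] at h
    rw [h, intervalIntegral.integral_of_le ht, ← Real.integral_rpow_mul_exp_neg_mul_Ioi hρ hM]
    refine setIntegral_mono_set hint ?_ (show Ioc 0 t ⊆ Ioi 0 from fun x hx => hx.1).eventuallyLE
    filter_upwards [ae_restrict_mem measurableSet_Ioi] with x hx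
    have : (0 : ℝ) < x := hx
    simp only [Pi.zero_apply]; positivity

/-- In the sup norm weighted by e^(-Mt), λ times the Abel integral of order ρ has norm at most λ
M^(-ρ). The choice M^ρ = 2λ makes this 1/2, so the weighted maximum N satisfies N ≤ N/2. -/
theorem eq_zero_of_volterra {E : Type*} [NormedAddCommGroup E] [NormedSpace ℝ E]
    {ρ lam T : ℝ} (hρ : 0 < ρ) (hlam : 0 < lam) {Y : ℝ → E}
    (hY : ContinuousOn Y (Icc 0 T))
    (h : ∀ t ∈ Icc 0 T, Real.Gamma ρ • Y t =
      -(lam • ∫ s in (0 : ℝ)..t, (t - s) ^ (ρ - 1) • Y s)) {t : ℝ} (ht : t ∈ Icc 0 T) :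
    Y t = 0 := by
  have hG := Real.Gamma_pos_of_pos hρ
  set M := (2 * lam) ^ (1 / ρ) with hMdef
  have hM : 0 < M := by positivity
  have hMρ : (1 / M) ^ ρ = 1 / (2 * lam) := by
    rw [Real.div_rpow zero_le_one hM.le, Real.one_rpow, hMdef, ← Real.rpow_mul (by positivity),
      one_div_mul_cancel hρ.ne', Real.rpow_one]
  have hg : ContinuousOn (fun t => Real.exp (-(M * t)) * ‖Y t‖) (Icc 0 T) :=
    ContinuousOn.mul (by fun_prop) hY.norm
  obtain ⟨z, hz, hmax⟩ := isCompact_Icc.exists_isMaxOn ⟨t, ht⟩ hg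
  set N := Real.exp (-(M * z)) * ‖Y z‖ with hN
  have hN0 : 0 ≤ N := by positivity
  have hbound : ∀ s ∈ Icc 0 T, ‖Y s‖ ≤ N * Real.exp (M * s) := by
    intro s hs
    have : Real.exp (-(M * s)) * ‖Y s‖ ≤ N := hmax hs
    rw [Real.exp_neg, inv_mul_eq_div, div_le_iff₀ (Real.exp_pos _)] at this
    exact this
  obtain ⟨hint, hle⟩ := integral_rpow_mul_exp_neg_le hρ hM hz.1
  have hI : ‖∫ s in (0 : ℝ)..z, (z - s) ^ (ρ - 1) • Y s‖ ≤
      N * Real.exp (M * z) * ((1 / M) ^ ρ * Real.Gamma ρ) := by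
    refine (intervalIntegral.norm_integral_le_of_norm_le hz.1 (g := fun s =>
      N * Real.exp (M * z) * ((z - s) ^ (ρ - 1) * Real.exp (-(M * (z - s)))))
      (ae_of_all _ fun s hs => ?_) (hint.const_mul _)).trans ?_
    · have h0 : 0 ≤ (z - s) ^ (ρ - 1) := Real.rpow_nonneg (by linarith [hs.2]) _
      rw [norm_smul, Real.norm_of_nonneg h0]
      have h1 := hbound s ⟨hs.1.le, hs.2.trans hz.2⟩
      have h2 : Real.exp (M * s) = Real.exp (M * z) * Real.exp (-(M * (z - s))) := by
        rw [← Real.exp_add]; congr 1; ring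
      calc (z - s) ^ (ρ - 1) * ‖Y s‖ ≤ (z - s) ^ (ρ - 1) * (N * Real.exp (M * s)) := by gcongr
        _ = _ := by rw [h2]; ring
    · rw [intervalIntegral.integral_const_mul]
      exact mul_le_mul_of_nonneg_left hle (by positivity)
  have hz' := congrArg norm (h z hz)
  rw [norm_neg, norm_smul, norm_smul, Real.norm_of_nonneg hG.le, Real.norm_of_nonneg hlam.le] at hz'
  have h3 : Real.Gamma ρ * ‖Y z‖ ≤ Real.Gamma ρ * (1 / 2 * (N * Real.exp (M * z))) := by
    rw [hz']
    refine (mul_le_mul_of_nonneg_left hI hlam.le).trans (le_of_eq ?_)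
    rw [hMρ]; field_simp
  have h4 := le_of_mul_le_mul_left h3 hG
  have h5 : N * Real.exp (M * z) = ‖Y z‖ := by
    rw [hN, mul_right_comm, ← Real.exp_add]; simp
  rw [h5] at h4
  have h6 : ‖Y z‖ = 0 := by linarith [norm_nonneg (Y z)]
  have h7 : N = 0 := by rw [hN, h6, mul_zero]
  have := hbound t ht
  rw [h7, zero_mul] at this
  exact norm_le_zero_iff.1 this

/-- The product of the Abel kernels of orders `ρ` and `1 - ρ`, cut off to `ξ < s`. -/
noncomputable def abelKernel (ρ t s ξ : ℝ) : ℝ :=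
  if ξ < s then (t - s) ^ (ρ - 1) * (s - ξ) ^ (-ρ) else 0

theorem measurable_abelKernel (ρ t : ℝ) :
    Measurable fun p : ℝ × ℝ => abelKernel ρ t p.1 p.2 := by
  unfold abelKernel
  refine Measurable.ite (measurableSet_lt measurable_snd measurable_fst) ?_ measurable_const
  exact ((measurable_const.sub measurable_fst).pow_const _).mul
    ((measurable_fst.sub measurable_snd).pow_const _)

/-- Abel kernels of orders ρ and 1 - ρ compose to a constant, by the Beta integral translated to [ξ,
t]. -/
theorem integral_abelKernel {ρ t ξ : ℝ} (hρ : 0 < ρ) (hρ1 : ρ < 1) (hξ : ξ ∈ Ioo 0 t) :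
    IntegrableOn (fun s => abelKernel ρ t s ξ) (Ioc 0 t) ∧
    ∫ s in Ioc 0 t, abelKernel ρ t s ξ = Real.Gamma ρ * Real.Gamma (1 - ρ) := by
  have hsub : 0 < t - ξ := sub_pos.2 hξ.2
  have hint := intervalIntegrable_rpow_mul_rpow hρ (b := 1 - ρ) (by linarith) hsub
  have hval := integral_rpow_mul_rpow hρ (b := 1 - ρ) (by linarith) hsub
  have hshift : (fun s : ℝ => (t - ξ - (s - ξ)) ^ (ρ - 1) * (s - ξ) ^ (1 - ρ - 1)) =
      fun s => (t - s) ^ (ρ - 1) * (s - ξ) ^ (-ρ) := by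
    ext s; rw [sub_sub_sub_cancel_right, show 1 - ρ - 1 = -ρ by ring]
  have hint' : IntegrableOn (fun s : ℝ => (t - s) ^ (ρ - 1) * (s - ξ) ^ (-ρ)) (Ioc ξ t) := by
    have := hint.comp_sub_right ξ
    rw [hshift, zero_add, sub_add_cancel] at this
    exact (intervalIntegrable_iff_integrableOn_Ioc_of_le hξ.2.le).1 this
  have hind : (fun s => abelKernel ρ t s ξ) =
      (Ioi ξ).indicator fun s => (t - s) ^ (ρ - 1) * (s - ξ) ^ (-ρ) := by
    ext s; simp [abelKernel, indicator, mem_Ioi]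
  have hinter : Ioc 0 t ∩ Ioi ξ = Ioc ξ t := by
    ext s; constructor
    · exact fun h => ⟨h.2, h.1.2⟩
    · exact fun h => ⟨⟨hξ.1.trans h.1, h.2⟩, h.1⟩
  rw [hind]
  constructor
  · rw [integrableOn_indicator_iff measurableSet_Ioi, inter_comm, hinter]
    exact hint'
  · rw [setIntegral_indicator measurableSet_Ioi, hinter, ← intervalIntegral.integral_of_le hξ.2.le]
    have := intervalIntegral.integral_comp_sub_right (a := ξ) (b := t)
      (fun s : ℝ => (t - ξ - s) ^ (ρ - 1) * s ^ (1 - ρ - 1)) ξ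
    rw [hshift, sub_self, hval] at this
    rw [this]; simp

/-- Fubini with `integral_abelKernel`: fractional integrals of orders 1 - ρ and ρ compose to the
ordinary primitive. -/
theorem integral_abel_comp {E : Type*} [NormedAddCommGroup E] [NormedSpace ℝ E]
    [CompleteSpace E] {ρ t : ℝ} (hρ : 0 < ρ) (hρ1 : ρ < 1) (ht : 0 ≤ t) {y : ℝ → E}
    (hy : IntervalIntegrable y volume 0 t) :
    ∫ s in (0 : ℝ)..t, (t - s) ^ (ρ - 1) • ∫ ξ in (0 : ℝ)..s, (s - ξ) ^ (-ρ) • y ξ =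
      (Real.Gamma ρ * Real.Gamma (1 - ρ)) • ∫ ξ in (0 : ℝ)..t, y ξ := by
  have hy' : IntegrableOn y (Ioc 0 t) := (intervalIntegrable_iff_integrableOn_Ioc_of_le ht).1 hy
  have hnn : ∀ s ∈ Ioc 0 t, ∀ ξ, 0 ≤ abelKernel ρ t s ξ := by
    intro s hs ξ
    unfold abelKernel
    split_ifs with h
    · exact mul_nonneg (Real.rpow_nonneg (by linarith [hs.2]) _) (Real.rpow_nonneg (by linarith) _)
    · exact le_rfl
  have hae : ∀ᵐ ξ ∂volume.restrict (Ioc 0 t), ξ ∈ Ioo 0 t := by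
    rw [← restrict_Ioo_eq_restrict_Ioc]
    exact ae_restrict_mem measurableSet_Ioo
  have hint : Integrable (Function.uncurry fun s ξ => abelKernel ρ t s ξ • y ξ)
      ((volume.restrict (Ioc 0 t)).prod (volume.restrict (Ioc 0 t))) := by
    refine (integrable_prod_iff' ?_).2 ⟨?_, ?_⟩
    · exact (measurable_abelKernel ρ t).aestronglyMeasurable.smul hy'.aestronglyMeasurable.comp_snd
    · filter_upwards [hae] with ξ hξ
      exact (integral_abelKernel hρ hρ1 hξ).1.smul_const (y ξ)
    · refine (hy'.norm.const_mul (Real.Gamma ρ * Real.Gamma (1 - ρ))).congr ?_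
      filter_upwards [hae] with ξ hξ
      rw [← (integral_abelKernel hρ hρ1 hξ).2, ← integral_mul_const]
      refine setIntegral_congr_fun measurableSet_Ioc fun s hs => ?_
      simp only [Function.uncurry_apply_pair, norm_smul, Real.norm_of_nonneg (hnn s hs ξ)]
  have hswap := integral_integral_swap hint
  have hR : ∫ ξ in Ioc 0 t, ∫ s in Ioc 0 t, abelKernel ρ t s ξ • y ξ =
      (Real.Gamma ρ * Real.Gamma (1 - ρ)) • ∫ ξ in (0 : ℝ)..t, y ξ := by
    rw [intervalIntegral.integral_of_le ht, ← integral_smul]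
    refine integral_congr_ae ?_
    filter_upwards [hae] with ξ hξ
    rw [integral_smul_const, (integral_abelKernel hρ hρ1 hξ).2]
  rw [← hR, ← hswap, intervalIntegral.integral_of_le ht]
  refine setIntegral_congr_fun measurableSet_Ioc fun s hs => ?_
  have hind : (fun ξ => abelKernel ρ t s ξ • y ξ) =
      (Iio s).indicator fun ξ => (t - s) ^ (ρ - 1) • ((s - ξ) ^ (-ρ) • y ξ) := by
    ext ξ
    by_cases h : ξ < s <;> simp [abelKernel, indicator, h, mul_smul]
  have hinter : Ioc 0 t ∩ Iio s = Ioo 0 s := by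
    ext ξ; constructor
    · exact fun h => ⟨h.1.1, h.2⟩
    · exact fun h => ⟨⟨h.1, h.2.le.trans hs.2⟩, h.2⟩
  simp only [hind]
  rw [setIntegral_indicator measurableSet_Iio, hinter, ← integral_Ioc_eq_integral_Ioo, integral_smul,
    ← intervalIntegral.integral_of_le hs.1.le]

theorem fracPrimitive_one {E : Type*} [NormedAddCommGroup E] [NormedSpace ℝ E] (h : ℝ → E) :
    fracPrimitive 1 h = h := by simp [fracPrimitive]

theorem fracPrimitive_of_lt {E : Type*} [NormedAddCommGroup E] [NormedSpace ℝ E] {ρ : ℝ}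
    (hρ1 : ρ < 1) (h : ℝ → E) {t : ℝ} (ht : 0 ≤ t) :
    fracPrimitive ρ h t =
      (1 / Real.Gamma (1 - ρ)) • ∫ ξ in (0 : ℝ)..t, (t - ξ) ^ (-ρ) • h ξ := by
  rw [fracPrimitive, if_neg hρ1.ne, fracIntegral, neg_sub]
  congr 1
  refine intervalIntegral.integral_congr fun ξ hξ => ?_
  rw [uIcc_of_le ht] at hξ
  rw [sub_add_cancel, Real.rpow_neg (by linarith [hξ.2]), one_div]

theorem HasRLDerivOn.sub {E : Type*} [NormedAddCommGroup E] [NormedSpace ℝ E] {ρ T : ℝ}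
    {h₁ h₂ D₁ D₂ : ℝ → E} (hρ1 : ρ ≤ 1) (H₁ : HasRLDerivOn ρ T h₁ D₁)
    (H₂ : HasRLDerivOn ρ T h₂ D₂) :
    HasRLDerivOn ρ T (h₁ - h₂) (D₁ - D₂) ∧
      EqOn (fracPrimitive ρ (h₁ - h₂)) (fracPrimitive ρ h₁ - fracPrimitive ρ h₂) (Ioc 0 T) := by
  have heq : EqOn (fracPrimitive ρ (h₁ - h₂)) (fracPrimitive ρ h₁ - fracPrimitive ρ h₂)
      (Ioc 0 T) := by
    intro t ht
    rcases hρ1.lt_or_eq with h | rfl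
    · simp only [fracPrimitive, if_neg h.ne, fracIntegral, Pi.sub_apply]
      rw [← smul_sub, ← intervalIntegral.integral_sub (H₁.integrable h t ht) (H₂.integrable h t ht)]
      simp only [smul_sub]
    · simp only [fracPrimitive_one]
  refine ⟨⟨fun h t ht => ?_, fun t ht => ?_⟩, heq⟩
  · simp only [Pi.sub_apply, smul_sub]
    exact (H₁.integrable h t ht).sub (H₂.integrable h t ht)
  · exact ((H₁.hasDeriv t ht).sub (H₂.hasDeriv t ht)).congr heq (heq ht)

theorem HasRLDerivOn.clm_comp {E F : Type*} [NormedAddCommGroup E] [NormedSpace ℝ E]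
    [CompleteSpace E] [NormedAddCommGroup F] [NormedSpace ℝ F] [CompleteSpace F] {ρ T : ℝ}
    {h D : ℝ → E} (hρ1 : ρ ≤ 1) (H : HasRLDerivOn ρ T h D) (L : E →L[ℝ] F) :
    HasRLDerivOn ρ T (fun t => L (h t)) (fun t => L (D t)) ∧
      EqOn (fracPrimitive ρ fun t => L (h t)) (fun t => L (fracPrimitive ρ h t)) (Ioc 0 T) := by
  have heq : EqOn (fracPrimitive ρ fun t => L (h t)) (fun t => L (fracPrimitive ρ h t))
      (Ioc 0 T) := by
    intro t ht
    rcases hρ1.lt_or_eq with h' | rfl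
    · simp only [fracPrimitive, if_neg h'.ne, fracIntegral]
      rw [map_smul, ← L.intervalIntegral_comp_comm (H.integrable h' t ht)]
      simp only [map_smul]
    · simp only [fracPrimitive_one]
  refine ⟨⟨fun h' t ht => ?_, fun t ht => ?_⟩, heq⟩
  · have := H.integrable h' t ht
    simp only [← map_smul]
    exact ⟨L.integrable_comp this.1, L.integrable_comp this.2⟩
  · exact (L.hasFDerivAt.comp_hasDerivWithinAt t (H.hasDeriv t ht)).congr heq (heq ht)

theorem HasRLDerivOn.intervalIntegrable {E : Type*} [NormedAddCommGroup E] [NormedSpace ℝ E]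
    {ρ T : ℝ} {y D : ℝ → E} (hρ : 0 < ρ) (hρ1 : ρ < 1) (hT : 0 < T) (H : HasRLDerivOn ρ T y D) :
    IntervalIntegrable y volume 0 T := by
  have h := H.integrable hρ1 T ⟨hT, le_rfl⟩
  have h2 := h.continuousOn_smul (f := fun ξ : ℝ => (T - ξ) ^ ρ)
    ((continuous_const.sub continuous_id).rpow_const fun _ => Or.inr hρ.le).continuousOn
  -- The open interval avoids ξ = T, where (T - ξ)^ρ vanishes and cannot be cancelled.
  rw [intervalIntegrable_iff_integrableOn_Ioo_of_le hT.le] at h2 ⊢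
  refine h2.congr_fun (fun ξ hξ => ?_) measurableSet_Ioo
  have : 0 < (T - ξ) ^ ρ := Real.rpow_pos_of_pos (by linarith [hξ.2]) ρ
  simp only [smul_smul, sub_add_cancel]
  rw [mul_one_div_cancel this.ne', one_smul]

/-- Uniqueness for the scalar equation `∂_t^ρ y + λ y = 0` with vanishing initial value. -/
theorem HasRLDerivOn.eq_zero {E : Type*} [NormedAddCommGroup E] [NormedSpace ℝ E]
    [CompleteSpace E] {ρ T lam : ℝ} {y D : ℝ → E} (hρ : 0 < ρ) (hρ1 : ρ ≤ 1) (hlam : 0 < lam)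
    (H : HasRLDerivOn ρ T y D) (hD : ∀ t ∈ Ioc 0 T, D t = -(lam • y t))
    (hc : ContinuousOn y (Ioc 0 T)) (hlim : Tendsto (fracPrimitive ρ y) (𝓝[>] 0) (𝓝 0))
    {t : ℝ} (ht : t ∈ Ioc 0 T) : y t = 0 := by
  have hT : 0 < T := ht.1.trans_le ht.2
  rcases hρ1.lt_or_eq with hlt | rfl
  · have hy := H.intervalIntegrable hρ hlt hT
    have hprim : ContinuousOn (fun s => ∫ ξ in (0 : ℝ)..s, y ξ) (Icc 0 T) := by
      have := intervalIntegral.continuousOn_primitive_interval (μ := volume) (f := y) (a := 0)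
        (b := T) (by
          rw [uIcc_of_le hT.le, integrableOn_Icc_iff_integrableOn_Ioc]
          exact (intervalIntegrable_iff_integrableOn_Ioc_of_le hT.le).1 hy)
      rwa [uIcc_of_le hT.le] at this
    -- The argument is run for the primitive, which is continuous up to 0, whereas y may be singular
    -- there.
    set Y : ℝ → E := fun s => ∫ ξ in (0 : ℝ)..s, y ξ with hYdef
    have hY0 : Tendsto Y (𝓝[>] 0) (𝓝 0) := by
      have h0 := hprim 0 ⟨le_rfl, hT.le⟩
      have h1 : Tendsto Y (𝓝[Icc 0 T] 0) (𝓝 0) := by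
        have h := h0.tendsto
        simpa [Y] using h
      refine h1.mono_left (nhdsWithin_le_of_mem ?_)
      filter_upwards [Ioc_mem_nhdsGT hT] with s hs using ⟨hs.1.le, hs.2⟩
    -- The equation integrated once: the left side has derivative zero and tends to 0 at 0.
    have hg : ∀ s ∈ Ioc 0 T, fracPrimitive ρ y s + lam • Y s = 0 := by
      intro s hs
      refine eq_zero_of_hasDerivWithinAt_zero (T := T)
        (G := fun s => fracPrimitive ρ y s + lam • Y s) (fun s hs => ?_) ?_ hs
      · refine ((H.hasDeriv s hs).add
          ((hasDerivWithinAt_integral_Ioc hy hc hs).const_smul lam)).congr_deriv ?_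
        rw [hD s hs, neg_add_cancel]
      · simpa using hlim.add (hY0.const_smul lam)
    -- Applying the Abel integral of order ρ to the integrated equation turns its first term into Y
    -- and leaves a Volterra equation.
    have hYzero : ∀ s ∈ Icc 0 T, Y s = 0 := by
      intro s hs
      refine eq_zero_of_volterra hρ hlam hprim (fun r hr => ?_) hs
      have hyr : IntervalIntegrable y volume 0 r := hy.mono_set (by
        rw [uIcc_of_le hr.1, uIcc_of_le hT.le]
        exact Icc_subset_Icc le_rfl hr.2)
      have h1 := integral_abel_comp hρ hlt hr.1 hyr
      have hG := Real.Gamma_pos_of_pos (show 0 < 1 - ρ by linarith)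
      have h2 : ∫ s in (0 : ℝ)..r, (r - s) ^ (ρ - 1) • ∫ ξ in (0 : ℝ)..s, (s - ξ) ^ (-ρ) • y ξ =
          ∫ s in (0 : ℝ)..r, Real.Gamma (1 - ρ) • -(lam • ((r - s) ^ (ρ - 1) • Y s)) := by
        rw [intervalIntegral.integral_of_le hr.1, intervalIntegral.integral_of_le hr.1]
        refine setIntegral_congr_fun measurableSet_Ioc fun s hs => ?_
        have h3 := hg s ⟨hs.1, hs.2.trans hr.2⟩
        rw [fracPrimitive_of_lt hlt y hs.1.le] at h3
        have h4 : ∫ ξ in (0 : ℝ)..s, (s - ξ) ^ (-ρ) • y ξ = Real.Gamma (1 - ρ) • -(lam • Y s) := by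
          rw [← eq_neg_of_add_eq_zero_left h3, smul_smul, mul_one_div_cancel hG.ne', one_smul]
        simp only [h4]
        rw [smul_comm, smul_neg, smul_comm lam]
      rw [h2, intervalIntegral.integral_smul, intervalIntegral.integral_neg,
        intervalIntegral.integral_smul, mul_comm, mul_smul] at h1
      exact (smul_right_injective E hG.ne' h1).symm
    have hder := hasDerivWithinAt_integral_Ioc hy hc ht
    have hder0 : HasDerivWithinAt Y 0 (Ioc 0 T) t :=
      (hasDerivWithinAt_const t (Ioc 0 T) (0 : E)).congr (fun s hs => hYzero s ⟨hs.1.le, hs.2⟩)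
        (hYzero t ⟨ht.1.le, ht.2⟩)
    exact ((uniqueDiffOn_Ioc 0 T) t ht).eq_deriv _ hder hder0
  · have hd := fun s hs => H.hasDeriv s hs
    simp only [fracPrimitive_one] at hd hlim
    have hexp : Continuous fun s : ℝ => Real.exp (lam * s) := by fun_prop
    have h := eq_zero_of_hasDerivWithinAt_zero (T := T) (G := fun s => Real.exp (lam * s) • y s)
      (fun s hs => ?_) ?_ ht
    · exact (smul_eq_zero.1 h).resolve_left (Real.exp_pos _).ne'
    · have he : HasDerivAt (fun s : ℝ => Real.exp (lam * s)) (Real.exp (lam * s) * lam) s := by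
        simpa using ((hasDerivAt_id s).const_mul lam).exp
      refine (he.hasDerivWithinAt.smul (hd s hs)).congr_deriv ?_
      rw [hD s hs, smul_neg, smul_smul, neg_add_cancel]
    · have h0 : Tendsto (fun s : ℝ => Real.exp (lam * s)) (𝓝[>] 0) (𝓝 (Real.exp (lam * 0))) :=
        (hexp.tendsto 0).mono_left nhdsWithin_le_nhds
      simpa using h0.smul hlim

/-! ### Diagonal operators in a Hilbert basis -/

section Coordinates

variable {𝕜 H ι : Type*} [RCLike 𝕜] [NormedAddCommGroup H] [InnerProductSpace 𝕜 H]

theorem HilbertBasis.ext_repr (v : HilbertBasis ι 𝕜 H) {x y : H}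
    (h : ∀ k, v.repr x k = v.repr y k) : x = y :=
  v.repr.injective (lp.ext (funext h))

theorem HilbertBasis.hasSum_norm_sq (v : HilbertBasis ι 𝕜 H) (x : H) :
    HasSum (fun k => ‖v.repr x k‖ ^ 2) (‖x‖ ^ 2) := by
  have h := lp.hasSum_norm (p := 2) (by norm_num) (v.repr x)
  simpa using h

open Classical in
/-- The operator that multiplies the coordinates in a Hilbert basis by the real numbers `m k`. -/
noncomputable def HilbertBasis.diag (v : HilbertBasis ι 𝕜 H) (m : ι → ℝ) (x : H) : H :=
  if h : Memℓp (fun k => m k • v.repr x k) 2 then v.repr.symm ⟨_, h⟩ else 0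

/-- Bounded multipliers keep the coordinates square summable, so the default value 0 in `diag` does
not occur. -/
theorem HilbertBasis.repr_diag (v : HilbertBasis ι 𝕜 H) {m : ι → ℝ} {B : ℝ}
    (hm : ∀ k, |m k| ≤ B) (x : H) (k : ι) : v.repr (v.diag m x) k = m k • v.repr x k := by
  have h : Memℓp (fun k => m k • v.repr x k) 2 := by
    refine memℓp_gen ?_
    refine Summable.of_nonneg_of_le (fun k => by positivity) (fun k => ?_)
      ((v.hasSum_norm_sq x).summable.mul_left (B ^ 2))
    rw [norm_smul, ← mul_pow]
    simp only [ENNReal.toReal_ofNat, Real.rpow_ofNat, Real.norm_eq_abs]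
    have := hm k
    gcongr
  rw [HilbertBasis.diag, dif_pos h, LinearIsometryEquiv.apply_symm_apply]

theorem HilbertBasis.norm_diag_le (v : HilbertBasis ι 𝕜 H) {m : ι → ℝ} {B : ℝ} (hB : 0 ≤ B)
    (hm : ∀ k, |m k| ≤ B) (x : H) : ‖v.diag m x‖ ≤ B * ‖x‖ := by
  refine le_of_sq_le_sq ?_ (by positivity)
  rw [mul_pow]
  refine hasSum_le (fun k => ?_) (v.hasSum_norm_sq _) ((v.hasSum_norm_sq x).mul_left (B ^ 2))
  rw [v.repr_diag hm, norm_smul, ← mul_pow, Real.norm_eq_abs]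
  have := hm k
  gcongr

/-- Dominated convergence in the Parseval sum. The multipliers need to converge only for each k, not
uniformly in k. -/
theorem HilbertBasis.tendsto_diag (v : HilbertBasis ι 𝕜 H) {α : Type*} {l : Filter α}
    {m : α → ι → ℝ} {m₀ : ι → ℝ} {B : ℝ} (hm : ∀ᶠ a in l, ∀ k, |m a k| ≤ B)
    (hm₀ : ∀ k, |m₀ k| ≤ B) (h : ∀ k, Tendsto (fun a => m a k) l (𝓝 (m₀ k))) (x : H) :
    Tendsto (fun a => v.diag (m a) x) l (𝓝 (v.diag m₀ x)) := by
  rw [tendsto_iff_norm_sub_tendsto_zero]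
  have key : Tendsto (fun a => ∑' k, ‖(m a k - m₀ k) • v.repr x k‖ ^ 2) l (𝓝 (∑' _ : ι, (0 : ℝ))) := by
    refine tendsto_tsum_of_dominated_convergence (bound := fun k => (2 * B) ^ 2 * ‖v.repr x k‖ ^ 2)
      ((v.hasSum_norm_sq x).summable.mul_left _) (fun k => ?_) ?_
    · have h1 := (((h k).sub_const (m₀ k)).smul_const (v.repr x k)).norm.pow 2
      simpa using h1
    · filter_upwards [hm] with a ha k
      rw [Real.norm_of_nonneg (by positivity), norm_smul, ← mul_pow, Real.norm_eq_abs]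
      have h1 := ha k
      have h2 := hm₀ k
      have h3 : |m a k - m₀ k| ≤ 2 * B := (abs_sub _ _).trans (by linarith)
      gcongr
  rw [tsum_zero] at key
  have key2 := (Real.continuous_sqrt.tendsto _).comp key
  rw [Real.sqrt_zero] at key2
  refine key2.congr' ?_
  filter_upwards [hm] with a ha
  have h1 := (v.hasSum_norm_sq (v.diag (m a) x - v.diag m₀ x)).tsum_eq
  have h2 : ∀ k, v.repr (v.diag (m a) x - v.diag m₀ x) k = (m a k - m₀ k) • v.repr x k := by
    intro k
    rw [map_sub, lp.coeFn_sub, Pi.sub_apply, v.repr_diag ha, v.repr_diag hm₀, sub_smul]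
  simp_rw [h2] at h1
  simp only [Function.comp_apply]
  rw [h1, Real.sqrt_sq (norm_nonneg _)]

theorem HilbertBasis.diag_one (v : HilbertBasis ι 𝕜 H) (x : H) : v.diag (fun _ => 1) x = x :=
  v.ext_repr fun k => by rw [v.repr_diag (B := 1) (fun _ => by simp), one_smul]

variable [NormedSpace ℝ H] [IsScalarTower ℝ 𝕜 H]

/-- The `k`-th coordinate in a Hilbert basis as a real-linear map. -/
noncomputable def HilbertBasis.coordCLM (v : HilbertBasis ι 𝕜 H) (k : ι) : H →L[ℝ] 𝕜 :=
  (innerSL 𝕜 (v k)).restrictScalars ℝ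

theorem HilbertBasis.coordCLM_apply (v : HilbertBasis ι 𝕜 H) (k : ι) (x : H) :
    v.coordCLM k x = v.repr x k := by
  rw [HilbertBasis.repr_apply_apply]; rfl

end Coordinates

/-! ### The operator in coordinates -/

section Graph

variable {𝕜 H ι : Type*} [RCLike 𝕜] [NormedAddCommGroup H] [InnerProductSpace 𝕜 H]

/-- The partial sums of the two expansions lie in the graph, and the graph is closed. -/
theorem LinearPMap.mem_graph_of_repr {A : H →ₗ.[𝕜] H} (hA : A.IsClosed) (v : HilbertBasis ι 𝕜 H)
    {lam : ι → ℝ} (hv : ∀ k, (v k, (lam k : 𝕜) • v k) ∈ A.graph) {x y : H}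
    (hxy : ∀ k, v.repr y k = (lam k : 𝕜) * v.repr x k) : (x, y) ∈ A.graph := by
  have h : HasSum (fun k => (v.repr x k • v k, v.repr y k • v k)) (x, y) :=
    (v.hasSum_repr x).prodMk (v.hasSum_repr y)
  refine hA.mem_of_tendsto h (Eventually.of_forall fun s => ?_)
  refine A.graph.sum_mem fun k _ => ?_
  have := A.graph.smul_mem (v.repr x k) (hv k)
  rwa [Prod.smul_mk, smul_smul, mul_comm, ← hxy] at this

/-- Symmetry of A moves it onto the eigenvector. -/
theorem LinearPMap.repr_of_mem_graph [CompleteSpace H] {A : H →ₗ.[𝕜] H}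
    (hd : Dense (A.domain : Set H)) (hA : IsSelfAdjoint A)
    (v : HilbertBasis ι 𝕜 H) {lam : ι → ℝ} (hv : ∀ k, (v k, (lam k : 𝕜) • v k) ∈ A.graph) {x y : H}
    (hxy : (x, y) ∈ A.graph) (k : ι) : v.repr y k = (lam k : 𝕜) * v.repr x k := by
  obtain ⟨x', hx', hy'⟩ := (LinearPMap.mem_graph_iff A).1 hxy
  obtain ⟨z, hz, hz'⟩ := (LinearPMap.mem_graph_iff A).1 (hv k)
  have hf := LinearPMap.adjoint_isFormalAdjoint hd
  rw [LinearPMap.isSelfAdjoint_def.1 hA] at hf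
  have h := hf z x'
  simp only at hx' hy' hz hz'
  rw [hz', hy', hz, hx', inner_smul_left, RCLike.conj_ofReal] at h
  rw [HilbertBasis.repr_apply_apply, HilbertBasis.repr_apply_apply, ← h]

end Graph

/-! ### Existence and uniqueness for the forward problem -/

theorem tendsto_relaxation_one {lam ρ : ℝ} (hρ : 0 < ρ) :
    Tendsto (relaxation lam ρ 1) (𝓝[>] 0) (𝓝 1) := by
  have h : Continuous fun t : ℝ => mittagLeffler ρ 1 (-lam * t ^ ρ) :=
    (continuous_mittagLeffler hρ one_pos).comp
      (continuous_const.mul (Real.continuous_rpow_const hρ.le))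
  have h0 : mittagLeffler ρ 1 (-lam * (0 : ℝ) ^ ρ) = 1 := by
    rw [Real.zero_rpow hρ.ne', mul_zero, mittagLeffler, tsum_eq_single 0]
    · simp
    · intro k hk; simp [hk]
  have h1 := (h.tendsto 0).mono_left (nhdsWithin_le_nhds (s := Ioi 0))
  rw [h0] at h1
  refine h1.congr fun t => ?_
  simp [relaxation]

section Existence

variable {𝕜 H ι : Type*} [RCLike 𝕜] [NormedAddCommGroup H] [InnerProductSpace 𝕜 H]

/-- The series solution `∑ e_{λ_k}(t) ⟨φ, v_k⟩ v_k` of the forward problem of order `ρ`. -/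
noncomputable def seriesSolution (v : HilbertBasis ι 𝕜 H) (lam : ι → ℝ) (φ : H) (ρ t : ℝ) : H :=
  v.diag (fun k => relaxation (lam k) ρ ρ t) φ

variable {v : HilbertBasis ι 𝕜 H} {lam : ι → ℝ} {ρ lam₁ : ℝ}

theorem abs_relaxation_le (hlam₁ : 0 < lam₁) (hlam : ∀ k, lam₁ ≤ lam k)
    (hρ : 0 < ρ) (hρ1 : ρ ≤ 1) {t : ℝ} (ht : 0 < t) (k : ι) :
    |relaxation (lam k) ρ ρ t| ≤ t ^ (ρ - 1) / Real.Gamma ρ := by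
  have hk := hlam₁.trans_le (hlam k)
  rw [abs_of_pos (relaxation_pos hk hρ hρ1 ht)]
  exact relaxation_le_rpow hk hρ hρ1 ht

theorem abs_mul_relaxation_le (hlam₁ : 0 < lam₁) (hlam : ∀ k, lam₁ ≤ lam k)
    (hρ : 0 < ρ) (hρ1 : ρ ≤ 1) {t : ℝ} (ht : 0 < t) (k : ι) :
    |lam k * relaxation (lam k) ρ ρ t| ≤ t⁻¹ := by
  have hk := hlam₁.trans_le (hlam k)
  rw [abs_of_pos (mul_pos hk (relaxation_pos hk hρ hρ1 ht))]
  exact mul_relaxation_le_inv hk hρ hρ1 ht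

theorem abs_relaxation_one_le (hlam₁ : 0 < lam₁) (hlam : ∀ k, lam₁ ≤ lam k)
    (hρ : 0 < ρ) (hρ1 : ρ ≤ 1) {t : ℝ} (ht : 0 < t) (k : ι) :
    |relaxation (lam k) ρ 1 t| ≤ 1 := by
  have hk := hlam₁.trans_le (hlam k)
  rw [abs_of_nonneg (relaxation_one_nonneg hk hρ hρ1 ht)]
  exact relaxation_one_le_one hk hρ hρ1 ht

/-- A decreasing bound B is dominated near t by its value at t/2, which supplies the local majorant.
-/
theorem HilbertBasis.continuousOn_diag (v : HilbertBasis ι 𝕜 H) {m : ℝ → ι → ℝ} {B : ℝ → ℝ}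
    (hB : AntitoneOn B (Ioi 0)) (hm : ∀ t, 0 < t → ∀ k, |m t k| ≤ B t)
    (hc : ∀ k, ContinuousOn (fun t => m t k) (Ioi 0)) (x : H) :
    ContinuousOn (fun t => v.diag (m t) x) (Ioi 0) := by
  intro t ht
  have ht' : (0 : ℝ) < t := ht
  refine ContinuousAt.continuousWithinAt ?_
  have hle : ∀ s, t / 2 < s → ∀ k, |m s k| ≤ B (t / 2) := fun s hs k =>
    (hm s ((half_pos ht').trans hs) k).trans
      (hB (half_pos ht') ((half_pos ht').trans hs) hs.le)
  refine v.tendsto_diag (B := B (t / 2)) ?_ (hle t (half_lt_self ht'))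
    (fun k => (hc k).continuousAt (Ioi_mem_nhds ht')) x
  filter_upwards [Ioi_mem_nhds (half_lt_self ht')] with s hs using hle s hs

theorem continuousOn_seriesSolution (hlam₁ : 0 < lam₁) (hlam : ∀ k, lam₁ ≤ lam k)
    (hρ : 0 < ρ) (hρ1 : ρ ≤ 1) (φ : H) :
    ContinuousOn (seriesSolution v lam φ ρ) (Ioi 0) := by
  refine v.continuousOn_diag (B := fun t => t ^ (ρ - 1) / Real.Gamma ρ) (fun s hs t ht hst => ?_)
    (fun t ht => abs_relaxation_le hlam₁ hlam hρ hρ1 ht)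
    (fun k => continuousOn_relaxation hρ hρ) φ
  have := (Real.Gamma_pos_of_pos hρ).le
  have h1 : t ^ (ρ - 1) ≤ s ^ (ρ - 1) :=
    Real.rpow_le_rpow_of_nonpos hs hst (by linarith)
  simp only
  gcongr

theorem continuousOn_operator_seriesSolution (hlam₁ : 0 < lam₁) (hlam : ∀ k, lam₁ ≤ lam k)
    (hρ : 0 < ρ) (hρ1 : ρ ≤ 1) (φ : H) :
    ContinuousOn (fun t => v.diag (fun k => lam k * relaxation (lam k) ρ ρ t) φ) (Ioi 0) := by
  refine v.continuousOn_diag (B := fun t => t⁻¹) (fun s hs t ht hst => inv_anti₀ hs hst)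
    (fun t ht => abs_mul_relaxation_le hlam₁ hlam hρ hρ1 ht)
    (fun k => continuousOn_const.mul (continuousOn_relaxation hρ hρ)) φ

variable [NormedSpace ℝ H]

theorem intervalIntegrable_seriesSolution (hlam₁ : 0 < lam₁) (hlam : ∀ k, lam₁ ≤ lam k)
    (hρ : 0 < ρ) (hρ1 : ρ < 1) (φ : H) {t : ℝ} (ht : 0 < t) :
    IntervalIntegrable (fun ξ : ℝ => (t - ξ) ^ (-ρ) • seriesSolution v lam φ ρ ξ) volume 0 t := by
  have hbound := ((intervalIntegrable_rpow_mul_rpow (a := 1 - ρ) (by linarith) hρ ht).const_mul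
    (‖φ‖ / Real.Gamma ρ))
  rw [intervalIntegrable_iff_integrableOn_Ioc_of_le ht.le] at hbound ⊢
  have hu := (continuousOn_seriesSolution (v := v) hlam₁ hlam hρ hρ1.le φ).mono
    (show Ioc 0 t ⊆ Ioi 0 from fun x hx => hx.1)
  refine hbound.mono' ?_ ?_
  · exact ((measurable_const.sub measurable_id).pow_const _).aestronglyMeasurable.smul
      (hu.aestronglyMeasurable measurableSet_Ioc)
  · filter_upwards [ae_restrict_mem measurableSet_Ioc] with ξ hξ
    have h0 : 0 ≤ (t - ξ) ^ (-ρ) := Real.rpow_nonneg (by linarith [hξ.2]) _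
    have hG := Real.Gamma_pos_of_pos hρ
    have h1 := v.norm_diag_le (div_nonneg (Real.rpow_nonneg hξ.1.le (ρ - 1)) hG.le)
      (abs_relaxation_le hlam₁ hlam hρ hρ1.le hξ.1) φ
    rw [norm_smul, Real.norm_of_nonneg h0, show 1 - ρ - 1 = -ρ by ring]
    calc _ ≤ (t - ξ) ^ (-ρ) * (ξ ^ (ρ - 1) / Real.Gamma ρ * ‖φ‖) :=
          mul_le_mul_of_nonneg_left h1 h0
      _ = _ := by ring

variable [IsScalarTower ℝ 𝕜 H]

/-- In each coordinate the integral of order 1 - ρ raises the second parameter from ρ to 1. -/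
theorem fracPrimitive_seriesSolution [CompleteSpace H] (hlam₁ : 0 < lam₁) (hlam : ∀ k, lam₁ ≤ lam k)
    (hρ : 0 < ρ) (hρ1 : ρ ≤ 1) (φ : H) {t : ℝ} (ht : 0 < t) :
    fracPrimitive ρ (seriesSolution v lam φ ρ) t =
      v.diag (fun k => relaxation (lam k) ρ 1 t) φ := by
  rcases hρ1.lt_or_eq with h | rfl
  · refine v.ext_repr fun k => ?_
    have hG := Real.Gamma_pos_of_pos (show 0 < 1 - ρ by linarith)
    rw [v.repr_diag (abs_relaxation_one_le hlam₁ hlam hρ hρ1 ht),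
      fracPrimitive_of_lt h _ ht.le, ← v.coordCLM_apply, map_smul,
      ← (v.coordCLM k).intervalIntegral_comp_comm
        (intervalIntegrable_seriesSolution hlam₁ hlam hρ h φ ht)]
    have h1 : ∫ ξ in (0 : ℝ)..t, v.coordCLM k ((t - ξ) ^ (-ρ) • seriesSolution v lam φ ρ ξ) =
        ∫ ξ in (0 : ℝ)..t, ((t - ξ) ^ (1 - ρ - 1) * relaxation (lam k) ρ ρ ξ) • v.repr φ k := by
      rw [intervalIntegral.integral_of_le ht.le, intervalIntegral.integral_of_le ht.le]
      refine setIntegral_congr_fun measurableSet_Ioc fun ξ hξ => ?_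
      simp only
      rw [map_smul, v.coordCLM_apply, seriesSolution,
        v.repr_diag (abs_relaxation_le hlam₁ hlam hρ hρ1 hξ.1), mul_smul,
        show 1 - ρ - 1 = -ρ by ring]
    rw [h1, intervalIntegral.integral_smul_const,
      integral_rpow_mul_relaxation hρ hρ (by linarith) ht, smul_smul, ← mul_assoc,
      one_div_mul_cancel hG.ne', one_mul, add_sub_cancel]
  · rw [fracPrimitive_one, seriesSolution]

theorem hasDerivAt_fracPrimitive_seriesSolution [CompleteSpace H] (hlam₁ : 0 < lam₁)
    (hlam : ∀ k, lam₁ ≤ lam k) (hρ : 0 < ρ) (hρ1 : ρ ≤ 1) (φ : H) {t : ℝ} (ht : 0 < t) :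
    HasDerivAt (fracPrimitive ρ (seriesSolution v lam φ ρ))
      (-v.diag (fun k => lam k * relaxation (lam k) ρ ρ t) φ) t := by
  set Au : ℝ → H := fun t => v.diag (fun k => lam k * relaxation (lam k) ρ ρ t) φ
  have hc : ContinuousOn Au (Ioi 0) := continuousOn_operator_seriesSolution hlam₁ hlam hρ hρ1 φ
  -- The primitive starts at 1, because the available bound 1/t for ‖A u‖ is not integrable at 0.
  have hint : ∀ s, 0 < s → IntervalIntegrable Au volume 1 s := fun s hs =>
    (hc.mono fun x hx => (lt_min one_pos hs).trans_le hx.1).intervalIntegrable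
  have hprim : ∀ s, 0 < s → fracPrimitive ρ (seriesSolution v lam φ ρ) s =
      v.diag (fun k => relaxation (lam k) ρ 1 1) φ - ∫ ξ in (1 : ℝ)..s, Au ξ := by
    intro s hs
    rw [fracPrimitive_seriesSolution hlam₁ hlam hρ hρ1 φ hs]
    refine v.ext_repr fun k => ?_
    rw [map_sub, lp.coeFn_sub, Pi.sub_apply,
      v.repr_diag (abs_relaxation_one_le hlam₁ hlam hρ hρ1 hs),
      v.repr_diag (abs_relaxation_one_le hlam₁ hlam hρ hρ1 one_pos),
      ← v.coordCLM_apply k (∫ ξ in (1 : ℝ)..s, Au ξ),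
      ← (v.coordCLM k).intervalIntegral_comp_comm (hint s hs)]
    have h1 : ∫ ξ in (1 : ℝ)..s, v.coordCLM k (Au ξ) =
        ∫ ξ in (1 : ℝ)..s, (lam k * relaxation (lam k) ρ ρ ξ) • v.repr φ k := by
      refine intervalIntegral.integral_congr fun ξ hξ => ?_
      have hξ0 : 0 < ξ := (lt_min one_pos hs).trans_le hξ.1
      simp only
      rw [v.coordCLM_apply, v.repr_diag (abs_mul_relaxation_le hlam₁ hlam hρ hρ1 hξ0)]
    have h2 := intervalIntegral.integral_interval_sub_left
      (intervalIntegrable_relaxation (lam := lam k) hρ hρ hs)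
      (intervalIntegrable_relaxation (lam := lam k) hρ hρ one_pos)
    rw [h1, intervalIntegral.integral_smul_const, intervalIntegral.integral_const_mul, ← h2,
      relaxation_one_eq hρ hs, relaxation_one_eq hρ one_pos, ← sub_smul]
    congr 1; ring
  have hFTC : HasDerivAt (fun s => ∫ ξ in (1 : ℝ)..s, Au ξ) (Au t) t :=
    intervalIntegral.integral_hasDerivAt_right (hint t ht)
      (hc.stronglyMeasurableAtFilter isOpen_Ioi t ht) (hc.continuousAt (Ioi_mem_nhds ht))
  have := (hFTC.const_sub (v.diag (fun k => relaxation (lam k) ρ 1 1) φ))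
  exact this.congr_of_eventuallyEq (by filter_upwards [Ioi_mem_nhds ht] with s hs using hprim s hs)

theorem isForwardSolution_seriesSolution [CompleteSpace H] {A : H →ₗ.[𝕜] H} (hA : A.IsClosed)
    (hv : ∀ k, (v k, (lam k : 𝕜) • v k) ∈ A.graph) (hlam₁ : 0 < lam₁)
    (hlam : ∀ k, lam₁ ≤ lam k) (hρ : 0 < ρ) (hρ1 : ρ ≤ 1) (φ : H) (T : ℝ) :
    IsForwardSolution A ρ T φ (seriesSolution v lam φ ρ) := by
  set Au : ℝ → H := fun t => v.diag (fun k => lam k * relaxation (lam k) ρ ρ t) φ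
  have hc : ContinuousOn Au (Ioc 0 T) :=
    (continuousOn_operator_seriesSolution hlam₁ hlam hρ hρ1 φ).mono fun x hx => hx.1
  refine ⟨fun t => -Au t, Au, ⟨fun h t ht => ?_, fun t ht => ?_⟩, fun t ht => ?_, hc.neg, hc,
    fun t _ => neg_add_cancel _, ?_⟩
  · refine (intervalIntegrable_seriesSolution (v := v) hlam₁ hlam hρ h φ ht.1).congr ?_
    intro ξ hξ
    rw [uIoc_of_le ht.1.le] at hξ
    simp only
    rw [sub_add_cancel, Real.rpow_neg (by linarith [hξ.2]), one_div]
  · exact (hasDerivAt_fracPrimitive_seriesSolution hlam₁ hlam hρ hρ1 φ ht.1).hasDerivWithinAt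
  · refine LinearPMap.mem_graph_of_repr hA v hv fun k => ?_
    rw [seriesSolution, v.repr_diag (abs_mul_relaxation_le hlam₁ hlam hρ hρ1 ht.1),
      v.repr_diag (abs_relaxation_le hlam₁ hlam hρ hρ1 ht.1), mul_smul,
      RCLike.real_smul_eq_coe_mul]
  · have h : Tendsto (fun t => v.diag (fun k => relaxation (lam k) ρ 1 t) φ) (𝓝[>] 0)
        (𝓝 (v.diag (fun _ => 1) φ)) := by
      refine v.tendsto_diag (B := 1) ?_ (fun k => by simp)
        (fun k => tendsto_relaxation_one hρ) φ
      filter_upwards [self_mem_nhdsWithin] with t ht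
      exact abs_relaxation_one_le hlam₁ hlam hρ hρ1 ht
    rw [v.diag_one] at h
    refine h.congr' ?_
    filter_upwards [self_mem_nhdsWithin] with t ht
    exact (fracPrimitive_seriesSolution hlam₁ hlam hρ hρ1 φ ht).symm

/-- Each coordinate of the difference solves ∂^ρ y + λ_k y = 0 with zero initial value. -/
theorem IsForwardSolution.eqOn [CompleteSpace H] {A : H →ₗ.[𝕜] H}
    (hd : Dense (A.domain : Set H)) (hA : IsSelfAdjoint A)
    (hv : ∀ k, (v k, (lam k : 𝕜) • v k) ∈ A.graph) (hlam : ∀ k, 0 < lam k) (hρ : 0 < ρ)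
    (hρ1 : ρ ≤ 1) {φ : H} {T : ℝ} {w u : ℝ → H} (hw : IsForwardSolution A ρ T φ w)
    (hu : IsForwardSolution A ρ T φ u) : EqOn w u (Ioc 0 T) := by
  obtain ⟨D₁, A₁, hD₁, hg₁, -, hc₁, he₁, hl₁⟩ := hw
  obtain ⟨D₂, A₂, hD₂, hg₂, -, hc₂, he₂, hl₂⟩ := hu
  intro t ht
  have hmem : Ioc 0 T ∈ 𝓝[>] (0 : ℝ) := Ioc_mem_nhdsGT (ht.1.trans_le ht.2)
  obtain ⟨hsub, hsubEq⟩ := hD₁.sub hρ1 hD₂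
  refine v.ext_repr fun k => ?_
  obtain ⟨hL, hLEq⟩ := hsub.clm_comp hρ1 (v.coordCLM k)
  have hcoord : ∀ s ∈ Ioc 0 T,
      v.coordCLM k ((A₁ - A₂) s) = lam k • v.coordCLM k ((w - u) s) := by
    intro s hs
    have h := A.graph.sub_mem (hg₁ s hs) (hg₂ s hs)
    rw [Prod.mk_sub_mk] at h
    rw [v.coordCLM_apply, v.coordCLM_apply, RCLike.real_smul_eq_coe_mul]
    exact LinearPMap.repr_of_mem_graph hd hA v hv h k
  have hy : v.coordCLM k ((w - u) t) = 0 := by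
    refine hL.eq_zero hρ hρ1 (hlam k) (fun s hs => ?_) ?_ ?_ ht
    · rw [← hcoord s hs, ← map_neg]
      congr 1
      simp only [Pi.sub_apply]
      rw [eq_neg_of_add_eq_zero_left (he₁ s hs), eq_neg_of_add_eq_zero_left (he₂ s hs)]
      abel
    -- Continuity is assumed for A u and not for u; in coordinates it passes to u on division by
    -- λ_k.
    · have h1 : ContinuousOn (fun s => (lam k)⁻¹ • v.coordCLM k ((A₁ - A₂) s)) (Ioc 0 T) :=
        ((v.coordCLM k).continuous.comp_continuousOn (hc₁.sub hc₂)).const_smul _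
      refine h1.congr fun s hs => ?_
      simp only
      rw [hcoord s hs, smul_smul, inv_mul_cancel₀ (hlam k).ne', one_smul]
    · have h1 := ((v.coordCLM k).continuous.tendsto _).comp (hl₁.sub hl₂)
      rw [sub_self, map_zero] at h1
      refine h1.congr' ?_
      filter_upwards [hmem] with s hs
      exact ((hLEq hs).trans (congrArg (v.coordCLM k) (hsubEq hs))).symm
  rw [Pi.sub_apply, map_sub, v.coordCLM_apply, v.coordCLM_apply] at hy
  exact sub_eq_zero.1 hy

end Existence

/-! ### Monotonicity of the norm -/

theorem norm_sq_seriesSolution {𝕜 H ι : Type*} [RCLike 𝕜] [NormedAddCommGroup H]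
    [InnerProductSpace 𝕜 H] {v : HilbertBasis ι 𝕜 H} {lam : ι → ℝ} {ρ lam₁ : ℝ}
    (hlam₁ : 0 < lam₁) (hlam : ∀ k, lam₁ ≤ lam k) (hρ : 0 < ρ) (hρ1 : ρ ≤ 1) (φ : H) {t : ℝ}
    (ht : 0 < t) :
    HasSum (fun k => relaxation (lam k) ρ ρ t ^ 2 * ‖v.repr φ k‖ ^ 2)
      (‖seriesSolution v lam φ ρ t‖ ^ 2) := by
  refine (v.hasSum_norm_sq _).congr_fun fun k => ?_
  rw [seriesSolution, v.repr_diag (abs_relaxation_le hlam₁ hlam hρ hρ1 ht), norm_smul, mul_pow,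
    Real.norm_eq_abs, sq_abs]

theorem lemma1 (ρ₀ lam₁ : ℝ) (hρ₀ : 0 < ρ₀) (hρ₀' : ρ₀ < 1) (hlam₁ : 0 < lam₁) :
    ∃ T₀ : ℝ, 0 < T₀ ∧
      -- the scalar functions `e_λ`
      (∀ t₀ : ℝ, T₀ ≤ t₀ → ∀ lam : ℝ, lam₁ ≤ lam →
        (∀ ρ ∈ Icc ρ₀ 1, 0 < t₀ ^ (ρ - 1) * mittagLeffler ρ ρ (-lam * t₀ ^ ρ)) ∧
        StrictAntiOn (fun ρ : ℝ => t₀ ^ (ρ - 1) * mittagLeffler ρ ρ (-lam * t₀ ^ ρ))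
          (Icc ρ₀ 1)) ∧
      -- every operator with smallest eigenvalue `lam₁`, every final time, every datum
      (∀ (𝕜 : Type*) [RCLike 𝕜] (H : Type*) [NormedAddCommGroup H] [InnerProductSpace 𝕜 H]
          [CompleteSpace H] [TopologicalSpace.SeparableSpace H]
          [NormedSpace ℝ H] [IsScalarTower ℝ 𝕜 H]
          (A : H →ₗ.[𝕜] H) (_ : IsPositiveSelfAdjoint A)
          (ι : Type*) (v : HilbertBasis ι 𝕜 H) (lam : ι → ℝ)
          (_ : ∀ k, (v k, (lam k : 𝕜) • v k) ∈ A.graph)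
          (_ : IsLeast (range lam) lam₁)
          (t₀ T : ℝ) (_ : T₀ ≤ t₀) (_ : t₀ ≤ T) (φ : H),
        ∃ u : ℝ → ℝ → H,
          -- `u ρ` is the solution, unique on `(0, T]`, of the forward problem of order `ρ`
          (∀ ρ ∈ Icc ρ₀ 1, IsForwardSolution A ρ T φ (u ρ) ∧
            ∀ w : ℝ → H, IsForwardSolution A ρ T φ w → EqOn w (u ρ) (Ioc 0 T)) ∧
          -- `W(t₀, ρ) = ‖u(t₀)‖²` decreases, strictly unless `φ = 0`
          AntitoneOn (fun ρ : ℝ => ‖u ρ t₀‖ ^ 2) (Icc ρ₀ 1) ∧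
          (φ ≠ 0 → StrictAntiOn (fun ρ : ℝ => ‖u ρ t₀‖ ^ 2) (Icc ρ₀ 1))) := by
  obtain ⟨T₀, hT₀, hanti⟩ := exists_strictAntiOn_relaxation hρ₀ hlam₁
  refine ⟨T₀, hT₀, fun t₀ ht₀ lam hlam => ⟨fun ρ hρ => ?_, hanti t₀ ht₀ lam hlam⟩, ?_⟩
  · exact relaxation_pos (hlam₁.trans_le hlam) (hρ₀.trans_le hρ.1) hρ.2 (hT₀.trans_le ht₀)
  · intro 𝕜 _ H _ _ _ _ _ _ A hA ι v lam hv hleast t₀ T ht₀ _ φ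
    have hlam : ∀ k, lam₁ ≤ lam k := fun k => hleast.2 ⟨k, rfl⟩
    have ht₀' : 0 < t₀ := hT₀.trans_le ht₀
    have hρpos : ∀ ρ ∈ Icc ρ₀ 1, 0 < ρ := fun ρ hρ => hρ₀.trans_le hρ.1
    have hsum : ∀ ρ ∈ Icc ρ₀ 1, HasSum (fun k => relaxation (lam k) ρ ρ t₀ ^ 2 * ‖v.repr φ k‖ ^ 2)
        (‖seriesSolution v lam φ ρ t₀‖ ^ 2) := fun ρ hρ =>
      norm_sq_seriesSolution hlam₁ hlam (hρpos ρ hρ) hρ.2 φ ht₀'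
    have hlt : ∀ ρ ∈ Icc ρ₀ 1, ∀ σ ∈ Icc ρ₀ 1, ρ < σ → ∀ k,
        relaxation (lam k) σ σ t₀ ^ 2 < relaxation (lam k) ρ ρ t₀ ^ 2 := fun ρ hρ σ hσ h k =>
      pow_lt_pow_left₀ (hanti t₀ ht₀ (lam k) (hlam k) hρ hσ h)
        (relaxation_pos (hlam₁.trans_le (hlam k)) (hρpos σ hσ) hσ.2 ht₀').le two_ne_zero
    refine ⟨seriesSolution v lam φ, fun ρ hρ => ?_, fun ρ hρ σ hσ h => ?_,
      fun hφ ρ hρ σ hσ h => ?_⟩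
    · have hu := isForwardSolution_seriesSolution hA.selfAdjoint.isClosed hv hlam₁ hlam
        (hρpos ρ hρ) hρ.2 φ T
      exact ⟨hu, fun w hw => hw.eqOn hA.dense hA.selfAdjoint hv
        (fun k => hlam₁.trans_le (hlam k)) (hρpos ρ hρ) hρ.2 hu⟩
    · rcases h.lt_or_eq with h | rfl
      · exact hasSum_le (fun k => mul_le_mul_of_nonneg_right (hlt ρ hρ σ hσ h k).le (by positivity))
          (hsum σ hσ) (hsum ρ hρ)
      · exact le_rfl
    -- A single nonzero coordinate of φ makes one term of the Parseval sum strictly smaller.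
    · obtain ⟨k, hk⟩ : ∃ k, v.repr φ k ≠ 0 := by
        by_contra! hzero
        exact hφ (v.ext_repr fun k => by rw [hzero k, map_zero]; rfl)
      refine hasSum_lt (i := k)
        (fun k => mul_le_mul_of_nonneg_right (hlt ρ hρ σ hσ h k).le (by positivity))
        (mul_lt_mul_of_pos_right (hlt ρ hρ σ hσ h k) (by positivity)) (hsum σ hσ) (hsum ρ hρ)
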